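/- **Setting.** Let $\mathfrak g$ be $B_n^{(1)}$ ($n\ge 2$), $C_n^{(1)}$ ($n\ge 2$) or $D_n^{(1)}$ ($n\ge 3$). Put $(h^\vee,t,s)=(2n-1,1,1),\ (n+1,2,-1),\ (2n-2,1,1)$ respectively and $\eta=-th^\vee/2$. Let $q\in\mathbb C^\times$, $r\in\mathbb C$ with $|p|<1$, $p=q^{2r}$ (powers are taken with the principal logarithm), and $$[u]=q^{r/4}e^{\pi i/4}\Big(-\frac{2\pi i}{\log p}\Big)^{-1/2}q^{u^2/r-u}\,\Theta_p(q^{2u}),\quad \Theta_p(z)=(z;p)_\infty(p/z;p)_\infty(p;p)_\infty,\quad (z;p)_\infty=\prod_{k\ge0}(1-zp^k).$$ Assume $[1]\ne0$ and, for $B_n^{(1)}$, $[2\eta]\neq 0$. Let $J=\{0,\pm1,\dots,\pm n\}$ for $B$ and $J=\{\pm1,\dots,\pm n\}$ for $C$, $D$; put $\widehat{\pm j}=\pm\varepsilon_j$ and $\hat 0=0$, where $\varepsilon_1,\dots,\varepsilon_n$ is the standard orthonormal basis. Fix $\lambda=\sum_i\lambda_i\varepsilon_i\in\mathbb C^n$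 that is generic: $[2\lambda_i+m]\ne0$ and $[\lambda_i\pm\lambda_j+m]\neq0$ for all $i\ne j$ and $m\in\mathbb Z$. Heights are the elements $a\in\lambda+\mathbb Z^n$; a pair $(a,b)$ of heights is admissible if $b-a=\hat\mu$ for some $\mu\in J$. Let $a_\mu=(a+\rho|\hat\mu)$ for $\mu\ne0$, where $\rho$ is the half sum of the positive roots of the underlying finite root system, and $a_0=-\tfrac12$; put $a_{\mu\nu}=a_\mu-a_\nu$ and $a_{\mu,-\nu}=a_\mu+a_\nu$. Let $$G_a=\epsilon(a)\prod_{i=1}^n h(a_i)\prod_{1\le i<j\le n}[a_i-a_j][a_i+a_j],\qquad G_{a\mu}=\frac{G_{a+\hat\mu}}{G_a},$$ where $h(x)=[x],[2x],1$ for $B,C,D$ and $\epsilon(\lambda+m)=s^{m_1+\dots+m_n}$ for $m\in\mathbb Z^n$. Fix any square roots $\sqrt{G_a}$, write $\sqrt{G_{a\mu}G_{a\nu}}=\frac{\sqrt{G_{a+\hat\mu}}\sqrt{G_{a+\hat\nu}}}{(\sqrt{G_a})^{2}}$ and $\sqrt{\frac{G_bG_c}{G_aG_d}}=\frac{\sqrt{G_b}\sqrt{G_c}}{\sqrt{G_a}\sqrt{G_d}}$,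 and fix, for all $a$ and $\mu\neq\pm\nu$, any square root $\sqrt{[a_{\mu\nu}+1][a_{\mu\nu}-1]}$ (the choice may depend on $(a,\mu,\nu)$). Identities in spectral parameters are identities of meromorphic functions, i.e. they hold for generic parameters: for all $u$ off a closed discrete set, and, in the Yang–Baxter equation, then for all $v$ off a closed discrete set that may depend on $u$. Let $\kappa$ satisfy $$\kappa(u)\kappa(-u)=1,\qquad \kappa(u)\kappa(\eta+u)=\frac{[-u][1+\eta+u]}{[1-u][\eta+u]} .$$ **Theorem.** Let $W\left(\begin{smallmatrix}a&b\\c&d\end{smallmatrix}\middle|u\right)$ be a function of four heights and of $u\in\mathbb C$. Write $W=\kappa(u)\overline W$. Suppose that $\overline W$ has the part (I) weights (for all heights $a$ and all $\mu,\nu\in J$ as indicated) $$\overline W\left(\begin{smallmatrix}a&a+\hat\mu\\a+\hat\mu&a+2\hat\mu\end{smallmatrix}\middle|u\right)=1\ (\mu\ne0),\quad \overline W\left(\begin{smallmatrix}a&a+\hat\mu\\a+\hat\mu&a+\hat\mu+\hat\nu\end{smallmatrix}\middle|u\right)=\frac{[1][a_{\mu\nu}-u]}{[1+u][a_{\mu\nu}]}\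 (\mu\ne\pm\nu),$$ $$\overline W\left(\begin{smallmatrix}a&a+\hat\nu\\a+\hat\mu&a+\hat\mu+\hat\nu\end{smallmatrix}\middle|u\right)=\frac{[u]\sqrt{[a_{\mu\nu}+1][a_{\mu\nu}-1]}}{[1+u][a_{\mu\nu}]}\ (\mu\ne\pm\nu),$$ and that $W$ satisfies the face type Yang–Baxter equation: for all $a,b,c,d,e,f$ with $(a,b),(b,c),(c,d),(a,f),(f,e),(e,d)$ admissible, $$\sum_g W\left(\begin{smallmatrix}f&g\\e&d\end{smallmatrix}\middle|u\right)W\left(\begin{smallmatrix}a&b\\f&g\end{smallmatrix}\middle|u+v\right)W\left(\begin{smallmatrix}b&c\\g&d\end{smallmatrix}\middle|v\right)=\sum_g W\left(\begin{smallmatrix}a&b\\g&c\end{smallmatrix}\middle|u\right)W\left(\begin{smallmatrix}g&c\\e&d\end{smallmatrix}\middle|u+v\right)W\left(\begin{smallmatrix}a&g\\f&e\end{smallmatrix}\middle|v\right)$$ (sums over the heights $g$ for which the pairs $(f,g),(b,g),(g,d)$, respectively $(a,g),(g,c),(g,e)$, are admissible), and the crossing symmetry: for all $a,b,c,d$ with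 $(a,b),(b,d),(a,c),(c,d)$ admissible, $$W\left(\begin{smallmatrix}a&b\\c&d\end{smallmatrix}\middle|u\right)=\sqrt{\frac{G_bG_c}{G_aG_d}}\;W\left(\begin{smallmatrix}c&a\\d&b\end{smallmatrix}\middle|\eta-u\right).$$ Then the remaining weights are uniquely determined, and they are the part (II) weights: for all heights $a$ and all $\mu,\nu\in J$, $$\overline W\left(\begin{smallmatrix}a&a+\hat\nu\\a+\hat\mu&a\end{smallmatrix}\middle|u\right)=\frac{[u][1][a_{\mu,-\nu}+1+\eta-u]}{[\eta-u][1+u][a_{\mu,-\nu}+1]}\sqrt{G_{a\mu}G_{a\nu}}\quad(\mu\ne\nu),$$ $$\overline W\left(\begin{smallmatrix}a&a+\hat\mu\\a+\hat\mu&a\end{smallmatrix}\middle|u\right)=\frac{[\eta+u][1][a_{\mu,-\mu}+1+2\eta-u]}{[\eta-u][1+u][a_{\mu,-\mu}+1+2\eta]}-\frac{[u][1][a_{\mu,-\mu}+1+\eta-u]}{[\eta-u][1+u][a_{\mu,-\mu}+1+2\eta]}\sum_{k\in J,\,k\ne\mu}\frac{[a_{\mu,-k}+1+2\eta]}{[a_{\mu,-k}+1]}\,G_{ak}.$$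 -/

import Mathlib

open Filter

noncomputable section

namespace FaceModel

/-! ### Elliptic theta function -/

/-- The infinite product `(z; p)_∞`. -/
def qProd (z p : ℂ) : ℂ := ∏' k : ℕ, (1 - z * p ^ k)

/-- `Θ_p(z) = (z; p)_∞ (p / z; p)_∞ (p; p)_∞`. -/
def bigTheta (p z : ℂ) : ℂ := qProd z p * qProd (p / z) p * qProd p p

/-- The elliptic nome `p = q^{2r}`. -/
def nome (q r : ℂ) : ℂ := q ^ (2 * r)

/-- The Jacobi theta function `[u]` with parameters `q` and `r`. -/
def theta (q r u : ℂ) : ℂ :=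
  q ^ (r / 4) * Complex.exp (Real.pi * Complex.I / 4)
    * (-(2 * Real.pi * Complex.I) / Complex.log (nome q r)) ^ (-(1 / 2) : ℂ)
    * q ^ (u ^ 2 / r - u) * bigTheta (nome q r) (q ^ (2 * u))

/-! ### Types, vector representations and heights -/

/-- The affine types `B_n^{(1)}`, `C_n^{(1)}`, `D_n^{(1)}`. -/
inductive AffType
  | B
  | C
  | D

/-- The smallest rank that is considered for each type. -/
def AffType.minRank : AffType → ℕ
  | .B => 2
  | .C => 2
  | .D => 3

/-- The dual Coxeter number `h^∨`. -/
def AffType.dualCoxeter (g : AffType) (n : ℕ) : ℂ :=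
  match g with
  | .B => 2 * n - 1
  | .C => n + 1
  | .D => 2 * n - 2

/-- `t = (long root)^2 / 2`. -/
def AffType.t : AffType → ℂ
  | .B => 1
  | .C => 2
  | .D => 1

/-- The sign `s`, the quotient of the sign factors of neighbouring heights. -/
def AffType.s : AffType → ℂ
  | .B => 1
  | .C => -1
  | .D => 1

/-- The crossing parameter `η = - t h^∨ / 2`. -/
def eta (g : AffType) (n : ℕ) : ℂ := -(g.t * g.dualCoxeter n) / 2

/-- Coordinates, in the orthonormal basis `ε_1, …, ε_n`, of the half sum `ρ` of positive roots
(`i : Fin n` stands for the index `i + 1`). -/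
def rho (g : AffType) (n : ℕ) (i : Fin n) : ℂ :=
  match g with
  | .B => n - (i : ℕ) - 1 / 2
  | .C => n - (i : ℕ)
  | .D => n - (i : ℕ) - 1

/-- The index set `J`: `{0, ±1, …, ±n}` for `B`, and `{±1, …, ±n}` for `C` and `D`. -/
def J (g : AffType) (n : ℕ) : Finset ℤ :=
  match g with
  | .B => Finset.Icc (-(n : ℤ)) n
  | .C => (Finset.Icc (-(n : ℤ)) n).erase 0
  | .D => (Finset.Icc (-(n : ℤ)) n).erase 0

/-- The weight `μ̂` of the vector representation: `± ε_j` for `μ = ± j`, and `0` for `μ = 0`. -/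
def hat {n : ℕ} (μ : ℤ) : Fin n → ℤ := fun i =>
  if μ = (i : ℤ) + 1 then 1 else if μ = -((i : ℤ) + 1) then -1 else 0

/-- The set `𝒜` of weights of the vector representation. -/
def weights (g : AffType) (n : ℕ) : Finset (Fin n → ℤ) := (J g n).image hat

/-- The pair of heights `(a, b)` is admissible: `b - a` is a weight of the vector representation.
An element `a : Fin n → ℤ` stands for the height `lam + ∑ i, a i • ε_i`, where `lam` is a fixed
base point of the dual of the Cartan subalgebra. -/
def Adm (g : AffType) (n : ℕ) (a b : Fin n → ℤ) : Prop := b - a ∈ weights g n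

instance (g : AffType) (n : ℕ) (a b : Fin n → ℤ) : Decidable (Adm g n a b) :=
  inferInstanceAs (Decidable (b - a ∈ weights g n))

/-- The dynamical variable `a_μ`: it is `(a + ρ | μ̂)` for `μ ≠ 0`, and `- 1 / 2` for `μ = 0`. -/
def coord (g : AffType) (n : ℕ) (lam : Fin n → ℂ) (a : Fin n → ℤ) (μ : ℤ) : ℂ :=
  if μ = 0 then -(1 / 2) else ∑ i, (lam i + a i + rho g n i) * (hat μ i : ℤ)

/-- `a_{μν} = a_μ - a_ν`. -/
def coordSub (g : AffType) (n : ℕ) (lam : Fin n → ℂ) (a : Fin n → ℤ) (μ ν : ℤ) : ℂ :=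
  coord g n lam a μ - coord g n lam a ν

/-- `a_{μ,-ν} = a_μ + a_ν`. -/
def coordAdd (g : AffType) (n : ℕ) (lam : Fin n → ℂ) (a : Fin n → ℤ) (μ ν : ℤ) : ℂ :=
  coord g n lam a μ + coord g n lam a ν

/-- Genericity of the base point: the heights stay away from all the theta divisors. -/
def Generic (n : ℕ) (q r : ℂ) (lam : Fin n → ℂ) : Prop :=
  ∀ m : ℤ, (∀ i, theta q r (2 * lam i + m) ≠ 0) ∧
    ∀ i j, i ≠ j → theta q r (lam i - lam j + m) ≠ 0 ∧ theta q r (lam i + lam j + m) ≠ 0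

/-! ### The character `G_a` -/

/-- The function `h`. -/
def hFun (g : AffType) (q r x : ℂ) : ℂ :=
  match g with
  | .B => theta q r x
  | .C => theta q r (2 * x)
  | .D => 1

/-- The principally specialized character `G_a`; the sign factor is normalized to be `1` at the
base point. -/
def G (g : AffType) (n : ℕ) (q r : ℂ) (lam : Fin n → ℂ) (a : Fin n → ℤ) : ℂ :=
  g.s ^ (∑ i, a i)
    * (∏ i : Fin n, hFun g q r (coord g n lam a ((i : ℤ) + 1)))
    * ∏ i : Fin n, ∏ j ∈ Finset.Ioi i,
        (theta q r (coord g n lam a ((i : ℤ) + 1) - coord g n lam a ((j : ℤ) + 1))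
          * theta q r (coord g n lam a ((i : ℤ) + 1) + coord g n lam a ((j : ℤ) + 1)))

/-- `G_{aμ} = G_{a + μ̂} / G_a`. -/
def Gratio (g : AffType) (n : ℕ) (q r : ℂ) (lam : Fin n → ℂ) (a : Fin n → ℤ) (μ : ℤ) : ℂ :=
  G g n q r lam (a + hat μ) / G g n q r lam a

/-- `rootG` is a choice of the square roots `√G_a`. -/
def IsRootG (g : AffType) (n : ℕ) (q r : ℂ) (lam : Fin n → ℂ)
    (rootG : (Fin n → ℤ) → ℂ) : Prop :=
  ∀ a, rootG a ^ 2 = G g n q r lam a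

/-- `rootT` is a choice of the square roots `√([a_{μν} + 1][a_{μν} - 1])`, `μ ≠ ±ν`. -/
def IsRootT (g : AffType) (n : ℕ) (q r : ℂ) (lam : Fin n → ℂ)
    (rootT : (Fin n → ℤ) → ℤ → ℤ → ℂ) : Prop :=
  ∀ a, ∀ μ ∈ J g n, ∀ ν ∈ J g n, μ ≠ ν → μ ≠ -ν →
    rootT a μ ν ^ 2 =
      theta q r (coordSub g n lam a μ ν + 1) * theta q r (coordSub g n lam a μ ν - 1)

/-! ### Face weights

A face weight is a function `W`, where `W a b c d u` stands for the weight of the face with the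
heights `a, b` in the first row and `c, d` in the second one.  Identities between functions of
spectral parameters are understood as identities between meromorphic functions: they hold for
all values of the parameters outside a closed discrete set. -/

/-- The relations for the scalar factor `κ`. -/
def IsKappa (g : AffType) (n : ℕ) (q r : ℂ) (κ : ℂ → ℂ) : Prop :=
  (∀ᶠ u in codiscrete ℂ, κ u * κ (-u) = 1) ∧
  (∀ᶠ u in codiscrete ℂ, κ u * κ (eta g n + u) =
    theta q r (-u) * theta q r (1 + eta g n + u)
      / (theta q r (1 - u) * theta q r (eta g n + u)))

/-- The weights of part (I). -/
def PartI (g : AffType) (n : ℕ) (q r : ℂ) (lam : Fin n → ℂ)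
    (rootT : (Fin n → ℤ) → ℤ → ℤ → ℂ) (κ : ℂ → ℂ)
    (W : (Fin n → ℤ) → (Fin n → ℤ) → (Fin n → ℤ) → (Fin n → ℤ) → ℂ → ℂ) : Prop :=
  (∀ a, ∀ μ ∈ J g n, μ ≠ 0 → ∀ᶠ u in codiscrete ℂ,
    W a (a + hat μ) (a + hat μ) (a + hat μ + hat μ) u = κ u * 1) ∧
  (∀ a, ∀ μ ∈ J g n, ∀ ν ∈ J g n, μ ≠ ν → μ ≠ -ν → ∀ᶠ u in codiscrete ℂ,
    W a (a + hat μ) (a + hat μ) (a + hat μ + hat ν) u =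
      κ u * (theta q r 1 * theta q r (coordSub g n lam a μ ν - u)
        / (theta q r (1 + u) * theta q r (coordSub g n lam a μ ν)))) ∧
  (∀ a, ∀ μ ∈ J g n, ∀ ν ∈ J g n, μ ≠ ν → μ ≠ -ν → ∀ᶠ u in codiscrete ℂ,
    W a (a + hat ν) (a + hat μ) (a + hat μ + hat ν) u =
      κ u * (theta q r u * rootT a μ ν
        / (theta q r (1 + u) * theta q r (coordSub g n lam a μ ν))))

/-- The weights of part (II). -/
def PartII (g : AffType) (n : ℕ) (q r : ℂ) (lam : Fin n → ℂ)
    (rootG : (Fin n → ℤ) → ℂ) (κ : ℂ → ℂ)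
    (W : (Fin n → ℤ) → (Fin n → ℤ) → (Fin n → ℤ) → (Fin n → ℤ) → ℂ → ℂ) : Prop :=
  (∀ a, ∀ μ ∈ J g n, ∀ ν ∈ J g n, μ ≠ ν → ∀ᶠ u in codiscrete ℂ,
    W a (a + hat ν) (a + hat μ) a u =
      κ u * (theta q r u * theta q r 1 * theta q r (coordAdd g n lam a μ ν + 1 + eta g n - u)
        / (theta q r (eta g n - u) * theta q r (1 + u)
            * theta q r (coordAdd g n lam a μ ν + 1))
        * (rootG (a + hat μ) / rootG a * (rootG (a + hat ν) / rootG a)))) ∧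
  (∀ a, ∀ μ ∈ J g n, ∀ᶠ u in codiscrete ℂ,
    W a (a + hat μ) (a + hat μ) a u =
      κ u * (theta q r (eta g n + u) * theta q r 1
          * theta q r (coordAdd g n lam a μ μ + 1 + 2 * eta g n - u)
          / (theta q r (eta g n - u) * theta q r (1 + u)
            * theta q r (coordAdd g n lam a μ μ + 1 + 2 * eta g n))
        - theta q r u * theta q r 1 * theta q r (coordAdd g n lam a μ μ + 1 + eta g n - u)
          / (theta q r (eta g n - u) * theta q r (1 + u)
            * theta q r (coordAdd g n lam a μ μ + 1 + 2 * eta g n))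
          * ∑ k ∈ (J g n).erase μ,
              theta q r (coordAdd g n lam a μ k + 1 + 2 * eta g n)
                / theta q r (coordAdd g n lam a μ k + 1) * Gratio g n q r lam a k))

/-- The face type Yang–Baxter equation.  On both sides `x` runs over all heights for which
the three faces are admissible. -/
def YangBaxter (g : AffType) (n : ℕ)
    (W : (Fin n → ℤ) → (Fin n → ℤ) → (Fin n → ℤ) → (Fin n → ℤ) → ℂ → ℂ) : Prop :=
  ∀ a b c d e f : Fin n → ℤ,
    Adm g n a b → Adm g n b c → Adm g n c d → Adm g n a f → Adm g n f e → Adm g n e d →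
    ∀ᶠ u in codiscrete ℂ, ∀ᶠ v in codiscrete ℂ,
      ∑ x ∈ ((weights g n).image (b + ·)).filter (fun x => Adm g n f x ∧ Adm g n x d),
          W f x e d u * W a b f x (u + v) * W b c x d v =
        ∑ x ∈ ((weights g n).image (a + ·)).filter (fun x => Adm g n x c ∧ Adm g n x e),
          W a b x c u * W x c e d (u + v) * W a x f e v

/-- The crossing symmetry. -/
def Crossing (g : AffType) (n : ℕ) (rootG : (Fin n → ℤ) → ℂ)
    (W : (Fin n → ℤ) → (Fin n → ℤ) → (Fin n → ℤ) → (Fin n → ℤ) → ℂ → ℂ) : Prop :=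
  ∀ a b c d : Fin n → ℤ,
    Adm g n a b → Adm g n b d → Adm g n a c → Adm g n c d →
    ∀ᶠ u in codiscrete ℂ,
      W a b c d u = rootG b * rootG c / (rootG a * rootG d) * W c a d b (eta g n - u)

end FaceModel

end

/-!
The proof determines all weights of part (II) from the crossing symmetry and from two families of
instances of the Yang–Baxter equation.

*Theta function.*  By the Jacobi triple product, `[u]` is Mathlib's `jacobiTheta₂` up to a Gaussian
factor (`theta_eq_jacobiTheta₂`).  The bilinear addition formula for `jacobiTheta₂` makes
`[x + y] [x - y]` an antisymmetric form of rank two in `x` and `y`, which gives the oddness of `[u]`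
and the three-term relation; the zeros of the infinite product are quasi-periods.
`IsThetaFunction` collects what is used of `[u]`.

*Faces with different inner steps.*  The crossing symmetry turns a part (I) weight of a path that
steps back along `-μ̂` and then along `ν̂` into the weight of the face `a, a + ν̂, a + μ̂, a`
(`weight_offDiagonal`).

*Diagonal weights with `μ ≠ 0`.*  In `ybe_reflect` two diagonal weights are unknown, one in the
parameter `u` and one in `v`.  After division by the known factors, their deviations from certain
expected values satisfy `F(u) [α - u - v] = K(v) [β - u - v]` with `[β - α] ≠ 0`; comparing zeros in
`v` shows `F = 0` (`IsThetaFunction.eventually_eq_zero`).  This gives a formula for the weight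
without a sum over `J` (`weight_diagonal`).

*The sum over `J`.*  In `ybe_pass` the left side is a single product while the right side runs over
all weights of the vector representation.  All weights in it are known by now, so that the
equation, specialized suitably, evaluates the sum over `J` of part (II): if `[η] ≠ 0`, the residue at
`u = η` is used (`pass_residue`, `sum_eq_of_theta_eta_ne_zero`), and if `[η] = 0`, the value at
`u = v = 0` (`sum_eq_of_quasiperiod`).  Both cases lead to `sum_identity`, which converts the formula
of `weight_diagonal` into the one of part (II).

*The zero weight in type `B`.*  With `σ = 0`, the residue relation `pass_residue` is linear in the
weight of the face with four equal heights and determines it; the sum in it splits into the sum of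
the claim and one that is known already (`weight_zero_eq`).

The Yang–Baxter equation is available only for generic `u` and then generic `v`; specializations
are justified by clearing denominators and by continuity (`eq_of_eventually_codiscrete`,
`eventually_of_linear`).
-/

open Filter

noncomputable section

namespace FaceModel

/-! ### The Jacobi triple product -/

/-- The finite product `(p; p)_M`. -/
def qFactorial (p : ℂ) (M : ℕ) : ℂ := ∏ i ∈ Finset.range M, (1 - p ^ (i + 1))

/-- The Gaussian binomial coefficient, extended by zero to `M < k`. -/
def qBinomial (p : ℂ) (M k : ℕ) : ℂ :=
  if k ≤ M then qFactorial p M / (qFactorial p k * qFactorial p (M - k)) else 0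

lemma one_sub_pow_ne_zero {p : ℂ} (hp : ‖p‖ < 1) (i : ℕ) : 1 - p ^ (i + 1) ≠ 0 := by
  intro h
  have h1 : ‖p ^ (i + 1)‖ = 1 := by rw [← sub_eq_zero.mp h]; simp
  rw [norm_pow] at h1
  exact absurd h1 (pow_lt_one₀ (norm_nonneg _) hp (by omega)).ne

lemma qFactorial_ne_zero {p : ℂ} (hp : ‖p‖ < 1) (M : ℕ) : qFactorial p M ≠ 0 :=
  Finset.prod_ne_zero_iff.mpr fun i _ => one_sub_pow_ne_zero hp i

lemma qFactorial_succ (p : ℂ) (M : ℕ) :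
    qFactorial p (M + 1) = qFactorial p M * (1 - p ^ (M + 1)) := by
  rw [qFactorial, Finset.prod_range_succ, ← qFactorial]

lemma qBinomial_zero {p : ℂ} (hp : ‖p‖ < 1) (M : ℕ) : qBinomial p M 0 = 1 := by
  have h := qFactorial_ne_zero hp M
  have h0 : qFactorial p 0 = 1 := by simp [qFactorial]
  simp [qBinomial, h0, div_self h]

lemma qBinomial_succ {p : ℂ} (hp : ‖p‖ < 1) {M k : ℕ} (hk : k ≤ M) :
    qBinomial p (M + 1) (k + 1) = qBinomial p M (k + 1) + p ^ (M - k) * qBinomial p M k := by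
  obtain ⟨j, rfl⟩ := Nat.exists_eq_add_of_le hk
  have h2 := qFactorial_ne_zero hp k
  have h4 := one_sub_pow_ne_zero hp k
  cases j with
  | zero =>
    simp only [qBinomial, add_zero, le_refl, if_true, Nat.sub_self]
    rw [if_neg (by omega)]
    have h0 : qFactorial p 0 = 1 := by simp [qFactorial]
    have h6 := qFactorial_ne_zero hp (k + 1)
    rw [h0]
    field_simp
    simp
  | succ j =>
    have h6 := one_sub_pow_ne_zero hp j
    simp only [qBinomial]
    rw [if_pos (by omega), if_pos (by omega), if_pos (by omega),
      show k + (j + 1) + 1 - (k + 1) = j + 1 by omega, show k + (j + 1) - (k + 1) = j by omega,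
      show k + (j + 1) - k = j + 1 by omega, qFactorial_succ p (k + (j + 1)),
      qFactorial_succ p k, qFactorial_succ p j]
    field_simp
    ring

/-- The `q`-binomial theorem. -/
lemma prod_one_add_mul_pow {s : ℂ} (hs : ‖s ^ 2‖ < 1) (y : ℂ) (M : ℕ) :
    ∏ i ∈ Finset.range M, (1 + y * s ^ (2 * i + 1)) =
      ∑ k ∈ Finset.range (M + 1), qBinomial (s ^ 2) M k * (s ^ (k ^ 2) * y ^ k) := by
  induction M with
  | zero => simp [qBinomial, qFactorial]
  | succ M ih =>
    have key : ∑ k ∈ Finset.range (M + 1),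
        qBinomial (s ^ 2) M (k + 1) * (s ^ ((k + 1) ^ 2) * y ^ (k + 1)) + 1 =
        ∑ k ∈ Finset.range (M + 1), qBinomial (s ^ 2) M k * (s ^ (k ^ 2) * y ^ k) := by
      have h := Finset.sum_range_succ'
        (fun k => qBinomial (s ^ 2) M k * (s ^ (k ^ 2) * y ^ k)) (M + 1)
      rw [Finset.sum_range_succ] at h
      have h0 : qBinomial (s ^ 2) M (M + 1) = 0 := if_neg (by omega)
      simpa [h0, qBinomial_zero hs] using h.symm
    rw [Finset.prod_range_succ, ih, Finset.sum_range_succ' _ (M + 1), mul_add, mul_one]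
    nth_rewrite 1 [← key]
    rw [Finset.sum_mul, add_right_comm, ← Finset.sum_add_distrib]
    congr 1
    · refine Finset.sum_congr rfl fun k hk => ?_
      have hk' : k ≤ M := by simpa [Nat.lt_succ_iff] using hk
      rw [qBinomial_succ hs hk']
      obtain ⟨j, rfl⟩ := Nat.exists_eq_add_of_le hk'
      rw [show k + j - k = j by omega]
      ring
    · simp [qBinomial_zero hs]

/-- The finite form of the Jacobi triple product. -/
lemma finite_triple_product {s y : ℂ} (hs0 : s ≠ 0) (hs : ‖s ^ 2‖ < 1) (hy : y ≠ 0) (N : ℕ) :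
    ∏ i ∈ Finset.range N, ((1 + y * s ^ (2 * i + 1)) * (1 + y⁻¹ * s ^ (2 * i + 1))) =
      ∑ k ∈ Finset.range (2 * N + 1), qBinomial (s ^ 2) (2 * N) k *
        (s ^ (((k : ℤ) - N) ^ 2) * y ^ ((k : ℤ) - N)) := by
  have h := prod_one_add_mul_pow hs (y * s ^ (-(2 * N : ℤ))) (2 * N)
  have h1 : ∏ i ∈ Finset.range (2 * N), (1 + y * s ^ (-(2 * N : ℤ)) * s ^ (2 * i + 1)) =
      (∏ i ∈ Finset.range N, ((1 + y * s ^ (2 * i + 1)) * (1 + y⁻¹ * s ^ (2 * i + 1)))) *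
        ∏ i ∈ Finset.range N, (y * s ^ (-(2 * i + 1 : ℤ))) := by
    have hA : ∏ i ∈ Finset.range N, (1 + y * s ^ (-(2 * N : ℤ)) * s ^ (2 * (N + i) + 1)) =
        ∏ i ∈ Finset.range N, (1 + y * s ^ (2 * i + 1)) := by
      refine Finset.prod_congr rfl fun i _ => ?_
      rw [mul_assoc, ← zpow_natCast, ← zpow_natCast, ← zpow_add₀ hs0,
        show -(2 * N : ℤ) + ((2 * (N + i) + 1 : ℕ) : ℤ) = ((2 * i + 1 : ℕ) : ℤ) by
          push_cast; ring]
    have hB : ∏ i ∈ Finset.range N, (1 + y * s ^ (-(2 * N : ℤ)) * s ^ (2 * i + 1)) =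
        (∏ i ∈ Finset.range N, (1 + y⁻¹ * s ^ (2 * i + 1))) *
          ∏ i ∈ Finset.range N, (y * s ^ (-(2 * i + 1 : ℤ))) := by
      rw [← Finset.prod_mul_distrib, ← Finset.prod_range_reflect]
      refine Finset.prod_congr rfl fun i hi => ?_
      have hi' := Finset.mem_range.mp hi
      have e1 : s ^ (-(2 * N : ℤ)) * s ^ (2 * (N - 1 - i) + 1) = s ^ (-(2 * i + 1 : ℤ)) := by
        rw [← zpow_natCast, ← zpow_add₀ hs0]
        congr 1
        omega
      have e2 : s ^ (2 * i + 1) * s ^ (-(2 * i + 1 : ℤ)) = 1 := by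
        rw [← zpow_natCast, ← zpow_add₀ hs0]
        simp
      rw [mul_assoc, e1]
      linear_combination -e2 - (y⁻¹ * y - 1) * e2 - inv_mul_cancel₀ hy
    rw [two_mul N, Finset.prod_range_add, hA, hB,
      Finset.prod_mul_distrib (f := fun i => 1 + y * s ^ (2 * i + 1))]
    ac_rfl
  have h2 : ∀ M : ℕ, ∏ i ∈ Finset.range M, (y * s ^ (-(2 * i + 1 : ℤ))) =
      y ^ (M : ℤ) * s ^ (-(M : ℤ) ^ 2) := by
    intro M
    induction M with
    | zero => simp
    | succ M ih =>
      rw [Finset.prod_range_succ, ih, mul_mul_mul_comm, ← zpow_add₀ hs0, ← zpow_add_one₀ hy]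
      congr 2
      push_cast
      ring
  rw [h1, h2] at h
  have h3 : y ^ (N : ℤ) * s ^ (-(N : ℤ) ^ 2) ≠ 0 :=
    mul_ne_zero (zpow_ne_zero _ hy) (zpow_ne_zero _ hs0)
  refine mul_right_cancel₀ h3 (h.trans ?_)
  rw [Finset.sum_mul]
  refine Finset.sum_congr rfl fun k _ => ?_
  rw [mul_assoc]
  congr 1
  have e1 : y ^ k = y ^ ((k : ℤ) - N) * y ^ (N : ℤ) := by
    rw [← zpow_add₀ hy, sub_add_cancel, zpow_natCast]
  have e2 : s ^ k ^ 2 * (s ^ (-(2 * N : ℤ))) ^ k =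
      s ^ (((k : ℤ) - N) ^ 2) * s ^ (-(N : ℤ) ^ 2) := by
    rw [← zpow_natCast, ← zpow_natCast, ← zpow_mul, ← zpow_add₀ hs0, ← zpow_add₀ hs0]
    congr 1
    push_cast
    ring
  rw [mul_pow, mul_left_comm, e2, e1]
  ring

lemma norm_exp_pi_I_mul_sq_lt_one {τ : ℂ} (hτ : 0 < τ.im) :
    ‖Complex.exp (Real.pi * Complex.I * τ) ^ 2‖ < 1 := by
  rw [norm_pow, Complex.norm_exp]
  refine pow_lt_one₀ (Real.exp_pos _).le ?_ two_ne_zero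
  rw [Real.exp_lt_one_iff]
  simp
  positivity

/-- The infinite form of the Jacobi triple product, for `jacobiTheta₂`. -/
lemma tendsto_triple_product {τ : ℂ} (hτ : 0 < τ.im) (w : ℂ) :
    Tendsto (fun N : ℕ => qFactorial (Complex.exp (Real.pi * Complex.I * τ) ^ 2) N *
      ∏ i ∈ Finset.range N,
        ((1 + Complex.exp (2 * Real.pi * Complex.I * w) *
            Complex.exp (Real.pi * Complex.I * τ) ^ (2 * i + 1)) *
          (1 + (Complex.exp (2 * Real.pi * Complex.I * w))⁻¹ *
            Complex.exp (Real.pi * Complex.I * τ) ^ (2 * i + 1))))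
      atTop (nhds (jacobiTheta₂ w τ)) := by
  set s := Complex.exp (Real.pi * Complex.I * τ) with hs
  set y := Complex.exp (2 * Real.pi * Complex.I * w) with hy
  have hs0 : s ≠ 0 := Complex.exp_ne_zero _
  have hy0 : y ≠ 0 := Complex.exp_ne_zero _
  have hs1 : ‖s ^ 2‖ < 1 := norm_exp_pi_I_mul_sq_lt_one hτ
  set F := qFactorial (s ^ 2) with hF
  -- `F` converges to a nonzero limit
  obtain ⟨L, hL0, hL⟩ : ∃ L : ℂ, L ≠ 0 ∧ Tendsto F atTop (nhds L) := by
    have hsum : Summable fun i : ℕ => ‖-(s ^ 2) ^ (i + 1)‖ := by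
      have h : ∀ i : ℕ, ‖-(s ^ 2) ^ (i + 1)‖ = ‖s ^ 2‖ ^ (i + 1) := fun i => by
        rw [norm_neg, norm_pow (s ^ 2)]
      simp_rw [h]
      exact (summable_nat_add_iff 1).mpr (summable_geometric_of_lt_one (norm_nonneg _) hs1)
    refine ⟨∏' i : ℕ, (1 + -(s ^ 2) ^ (i + 1)), tprod_one_add_ne_zero_of_summable (fun i => ?_) hsum,
      ?_⟩
    · rw [← sub_eq_add_neg]
      exact one_sub_pow_ne_zero hs1 i
    · have := (multipliable_one_add_of_summable hsum).tendsto_prod_tprod_nat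
      refine this.congr fun M => ?_
      simp only [hF, qFactorial, sub_eq_add_neg]
  obtain ⟨B, hB⟩ : ∃ B, ∀ M, ‖F M‖ ≤ B := by
    obtain ⟨B, hB⟩ := hL.norm.bddAbove_range
    exact ⟨B, fun M => hB ⟨M, rfl⟩⟩
  obtain ⟨B', hB'⟩ : ∃ B, ∀ M, ‖(F M)⁻¹‖ ≤ B := by
    obtain ⟨B, hB⟩ := (hL.inv₀ hL0).norm.bddAbove_range
    exact ⟨B, fun M => hB ⟨M, rfl⟩⟩
  have hBn : 0 ≤ B := (norm_nonneg _).trans (hB 0)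
  have hBn' : 0 ≤ B' := (norm_nonneg _).trans (hB' 0)
  -- the coefficients of the finite triple product, with the index shifted by `N` so that it runs
  -- from `-N` to `N`
  let C : ℕ → ℤ → ℂ := fun N n =>
    if -(N : ℤ) ≤ n then F N * qBinomial (s ^ 2) (2 * N) (n + N).toNat else 0
  have hterm : ∀ n : ℤ, s ^ (n ^ 2) * y ^ n = jacobiTheta₂_term n w τ := by
    intro n
    rw [jacobiTheta₂_term, hs, hy, ← Complex.exp_int_mul, ← Complex.exp_int_mul, ← Complex.exp_add]
    congr 1
    push_cast
    ring
  have hprod : ∀ N : ℕ, F N * ∏ i ∈ Finset.range N,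
      ((1 + y * s ^ (2 * i + 1)) * (1 + y⁻¹ * s ^ (2 * i + 1))) =
        ∑' n : ℤ, C N n * jacobiTheta₂_term n w τ := by
    intro N
    have hinj : Function.Injective fun k : ℕ => (k : ℤ) - N := fun a b h => by simpa using h
    rw [finite_triple_product hs0 hs1 hy0, ← hinj.tsum_eq, tsum_eq_sum (s := Finset.range (2 * N + 1)),
      Finset.mul_sum]
    · refine Finset.sum_congr rfl fun k _ => ?_
      simp only [C]
      rw [if_pos (by omega), hterm, sub_add_cancel, Int.toNat_natCast, mul_assoc]
    · intro k hk
      simp only [Finset.mem_range, not_lt] at hk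
      simp only [C]
      rw [if_pos (by omega), sub_add_cancel, Int.toNat_natCast, qBinomial, if_neg (by omega)]
      simp
    · intro n hn
      by_cases h : -(N : ℤ) ≤ n
      · exact ⟨(n + N).toNat, by simp only; omega⟩
      · simp [C, h] at hn
  simp_rw [hprod]
  have hlim : ∀ n, Tendsto (fun N => C N n) atTop (nhds 1) := by
    intro n
    have e1 : Tendsto (fun N : ℕ => (n + N).toNat) atTop atTop :=
      tendsto_atTop.mpr fun b => by
        filter_upwards [eventually_ge_atTop (b + n.natAbs)] with N hN
        omega
    have e2 : Tendsto (fun N : ℕ => 2 * N - (n + N).toNat) atTop atTop :=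
      tendsto_atTop.mpr fun b => by
        filter_upwards [eventually_ge_atTop (b + n.natAbs)] with N hN
        omega
    have e3 : Tendsto (fun N : ℕ => 2 * N) atTop atTop :=
      tendsto_atTop.mpr fun b => by
        filter_upwards [eventually_ge_atTop b] with N hN
        omega
    have h := hL.mul ((hL.comp e3).div ((hL.comp e1).mul (hL.comp e2)) (mul_ne_zero hL0 hL0))
    rw [show L * (L / (L * L)) = 1 by field_simp] at h
    refine h.congr' ?_
    filter_upwards [eventually_ge_atTop n.natAbs] with N hN
    simp only [C, qBinomial]
    rw [if_pos (by omega), if_pos (by omega)]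
    rfl
  have hbound : ∀ N n, ‖C N n‖ ≤ B * (B * (B' * B')) := by
    intro N n
    simp only [C, qBinomial]
    split_ifs
    · rw [div_eq_mul_inv, mul_inv, norm_mul, norm_mul, norm_mul]
      gcongr
      exacts [hB _, hB _, hB' _, hB' _]
    · simp
      positivity
    · simp
      positivity
  have hsum := (summable_jacobiTheta₂_term_iff w τ).mpr hτ
  have := tendsto_tsum_of_dominated_convergence (𝓕 := atTop)
    (f := fun N n => C N n * jacobiTheta₂_term n w τ) (g := fun n => 1 * jacobiTheta₂_term n w τ)
    (hsum.norm.mul_left (B * (B * (B' * B')))) (fun n => (hlim n).mul_const _)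
    (Eventually.of_forall fun N n => by
      rw [norm_mul]
      exact mul_le_mul_of_nonneg_right (hbound N n) (norm_nonneg _))
  simpa only [one_mul, jacobiTheta₂] using this

/-! ### The theta function `[u]` -/

lemma summable_norm_neg_mul_pow {p : ℂ} (hp : ‖p‖ < 1) (z : ℂ) :
    Summable fun k : ℕ => ‖-(z * p ^ k)‖ := by
  have h : ∀ k : ℕ, ‖-(z * p ^ k)‖ = ‖z‖ * ‖p‖ ^ k := fun k => by
    rw [norm_neg, norm_mul, norm_pow]
  simp_rw [h]
  exact (summable_geometric_of_lt_one (norm_nonneg _) hp).mul_left _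

lemma tendsto_qProd {p : ℂ} (hp : ‖p‖ < 1) (z : ℂ) :
    Tendsto (fun N : ℕ => ∏ k ∈ Finset.range N, (1 - z * p ^ k)) atTop (nhds (qProd z p)) := by
  have := (multipliable_one_add_of_summable
    (summable_norm_neg_mul_pow hp z)).tendsto_prod_tprod_nat
  simpa only [← sub_eq_add_neg, qProd] using this

lemma exists_of_qProd_eq_zero {p : ℂ} (hp : ‖p‖ < 1) {z : ℂ} (h : qProd z p = 0) :
    ∃ k : ℕ, z * p ^ k = 1 := by
  by_contra! hz
  refine tprod_one_add_ne_zero_of_summable (fun k => ?_) (summable_norm_neg_mul_pow hp z)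
    (by simpa only [← sub_eq_add_neg, qProd] using h)
  rw [← sub_eq_add_neg, sub_ne_zero]
  exact (hz k).symm

/-- The Jacobi triple product. -/
lemma bigTheta_eq_jacobiTheta₂ {τ : ℂ} (hτ : 0 < τ.im) (w : ℂ) :
    bigTheta (Complex.exp (Real.pi * Complex.I * τ) ^ 2)
      (-(Complex.exp (2 * Real.pi * Complex.I * w) * Complex.exp (Real.pi * Complex.I * τ))) =
    jacobiTheta₂ w τ := by
  refine tendsto_nhds_unique ?_ (tendsto_triple_product hτ w)
  have hs1 := norm_exp_pi_I_mul_sq_lt_one hτ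
  set s := Complex.exp (Real.pi * Complex.I * τ) with hs
  set y := Complex.exp (2 * Real.pi * Complex.I * w) with hy
  refine (((tendsto_qProd hs1 (-(y * s))).mul (tendsto_qProd hs1 (s ^ 2 / -(y * s)))).mul
    (tendsto_qProd hs1 (s ^ 2))).congr fun N => ?_
  rw [mul_comm, ← Finset.prod_mul_distrib, qFactorial]
  congr 1
  · refine Finset.prod_congr rfl fun i _ => ?_
    ring
  · refine Finset.prod_congr rfl fun i _ => ?_
    congr 1
    · ring
    · field_simp
      ring

lemma hasSum_jacobiTheta₂_mul {τ : ℂ} (hτ : 0 < τ.im) (a b : ℂ) :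
    HasSum (fun x : ℤ × ℤ => jacobiTheta₂_term x.1 a τ * jacobiTheta₂_term x.2 b τ)
      (jacobiTheta₂ a τ * jacobiTheta₂ b τ) := by
  have ha := (summable_jacobiTheta₂_term_iff a τ).mpr hτ
  have hb := (summable_jacobiTheta₂_term_iff b τ).mpr hτ
  have h := summable_mul_of_summable_norm (f := fun n => jacobiTheta₂_term n a τ)
    (g := fun n => jacobiTheta₂_term n b τ) ha.norm hb.norm
  rw [jacobiTheta₂, jacobiTheta₂, ha.tsum_mul_tsum hb h]
  exact h.hasSum

/-- The inclusions of the pairs with even and with odd sum into `ℤ × ℤ`, in the coordinates given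
by half the sum and half the difference. -/
def parityMap : (ℤ × ℤ) ⊕ (ℤ × ℤ) → ℤ × ℤ
  | .inl x => (x.1 + x.2, x.1 - x.2)
  | .inr x => (x.1 + x.2 + 1, x.1 - x.2)

lemma parityMap_bijective : Function.Bijective parityMap := by
  constructor
  · rintro (⟨a, b⟩ | ⟨a, b⟩) (⟨c, d⟩ | ⟨c, d⟩) h <;>
      simp only [parityMap, Prod.mk.injEq] at h
    · congr 2 <;> omega
    · omega
    · omega
    · congr 2 <;> omega
  · rintro ⟨x, y⟩
    obtain h | h : (x + y) % 2 = 0 ∨ (x + y) % 2 = 1 := by omega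
    · exact ⟨.inl ((x + y) / 2, (x - y) / 2), by
        simp only [parityMap, Prod.mk.injEq]; omega⟩
    · exact ⟨.inr ((x + y) / 2, (x - y) / 2), by
        simp only [parityMap, Prod.mk.injEq]; omega⟩

/-- The bilinear addition formula for `jacobiTheta₂`: the sum over `ℤ × ℤ` is split according to
the parity of the sum of the two indices. -/
lemma jacobiTheta₂_add_mul_sub {τ : ℂ} (hτ : 0 < τ.im) (s t : ℂ) :
    jacobiTheta₂ (s + t) τ * jacobiTheta₂ (s - t) τ =
      jacobiTheta₂ (2 * s) (2 * τ) * jacobiTheta₂ (2 * t) (2 * τ) +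
        Complex.exp (2 * Real.pi * Complex.I * (s + t) + Real.pi * Complex.I * τ) *
          (jacobiTheta₂ (2 * s + τ) (2 * τ) * jacobiTheta₂ (2 * t + τ) (2 * τ)) := by
  have hτ2 : 0 < (2 * τ).im := by simpa using hτ
  have h1 := (Equiv.ofBijective parityMap parityMap_bijective).hasSum_iff.mpr
    (hasSum_jacobiTheta₂_mul hτ (s + t) (s - t))
  refine h1.unique (HasSum.sum ?_ ?_)
  · have h2 := hasSum_jacobiTheta₂_mul hτ2 (2 * s) (2 * t)
    refine h2.congr_fun fun x => ?_
    simp only [Function.comp, Equiv.ofBijective_apply, parityMap, jacobiTheta₂_term,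
      ← Complex.exp_add]
    congr 1
    push_cast
    ring
  · have h2 := (hasSum_jacobiTheta₂_mul hτ2 (2 * s + τ) (2 * t + τ)).mul_left
      (Complex.exp (2 * Real.pi * Complex.I * (s + t) + Real.pi * Complex.I * τ))
    refine h2.congr_fun fun x => ?_
    simp only [Function.comp, Equiv.ofBijective_apply, parityMap, jacobiTheta₂_term,
      ← Complex.exp_add]
    congr 1
    push_cast
    ring

section
variable {q r : ℂ}

/-- The modulus `τ` with `p = exp (2 π i τ)`. -/
def modulus (q r : ℂ) : ℂ := r * Complex.log q / (Real.pi * Complex.I)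

lemma modulus_im_pos (hq : q ≠ 0) (hp : ‖nome q r‖ < 1) : 0 < (modulus q r).im := by
  rw [nome, Complex.cpow_def_of_ne_zero hq, Complex.norm_exp, Real.exp_lt_one_iff] at hp
  have h : (Complex.log q * (2 * r)).re = -(2 * Real.pi) * (modulus q r).im := by
    have : Complex.log q * (2 * r) = ((2 * Real.pi : ℝ) : ℂ) * (Complex.I * modulus q r) := by
      rw [modulus]
      have := Complex.ofReal_ne_zero.mpr Real.pi_ne_zero
      field_simp [Complex.I_ne_zero]
      push_cast
      ring
    rw [this, Complex.re_ofReal_mul]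
    simp
  rw [h] at hp
  have := Real.pi_pos
  nlinarith

lemma bigTheta_cpow (hq : q ≠ 0) (hp : ‖nome q r‖ < 1) (u : ℂ) :
    bigTheta (nome q r) (q ^ (2 * u)) =
      jacobiTheta₂ (u * Complex.log q / (Real.pi * Complex.I) + 1 / 2 - modulus q r / 2)
        (modulus q r) := by
  rw [← bigTheta_eq_jacobiTheta₂ (modulus_im_pos hq hp), nome, Complex.cpow_def_of_ne_zero hq,
    Complex.cpow_def_of_ne_zero hq]
  congr 1
  · rw [← Complex.exp_nat_mul, modulus]
    congr 1
    field_simp [Complex.I_ne_zero]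
    push_cast
    ring
  · rw [← Complex.exp_add, ← mul_neg_one, ← Complex.exp_pi_mul_I, ← Complex.exp_add, eq_comm,
      Complex.exp_eq_exp_iff_exists_int]
    refine ⟨1, ?_⟩
    field_simp [Complex.I_ne_zero]
    push_cast
    ring

/-- Up to a constant and a Gaussian factor, `[u]` is Mathlib's theta function. -/
lemma theta_eq_jacobiTheta₂ (hq : q ≠ 0) (hp : ‖nome q r‖ < 1) : ∃ c : ℂ, ∀ u,
    theta q r u = c * Complex.exp (Complex.log q * (u ^ 2 / r - u)) *
      jacobiTheta₂ (u * Complex.log q / (Real.pi * Complex.I) + 1 / 2 - modulus q r / 2)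
        (modulus q r) := by
  refine ⟨q ^ (r / 4) * Complex.exp (Real.pi * Complex.I / 4)
    * (-(2 * Real.pi * Complex.I) / Complex.log (nome q r)) ^ (-(1 / 2) : ℂ), fun u => ?_⟩
  rw [theta, bigTheta_cpow hq hp, Complex.cpow_def_of_ne_zero hq (u ^ 2 / r - u)]

lemma differentiable_theta (hq : q ≠ 0) (hp : ‖nome q r‖ < 1) :
    Differentiable ℂ (theta q r) := by
  obtain ⟨c, hc⟩ := theta_eq_jacobiTheta₂ hq hp
  rw [show theta q r = _ from funext hc]
  have h : Differentiable ℂ fun z => jacobiTheta₂ z (modulus q r) := fun z =>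
    differentiableAt_jacobiTheta₂_fst z (modulus_im_pos hq hp)
  have h2 : Differentiable ℂ fun u : ℂ =>
      u * Complex.log q / (Real.pi * Complex.I) + 1 / 2 - modulus q r / 2 := by fun_prop
  have h3 : Differentiable ℂ fun u : ℂ => c * Complex.exp (Complex.log q * (u ^ 2 / r - u)) := by
    fun_prop
  exact h3.mul (h.comp h2)

/-- The products `[x + y] [x - y]` form an antisymmetric bilinear expression of rank two. -/
lemma theta_add_mul_theta_sub (hq : q ≠ 0) (hp : ‖nome q r‖ < 1) : ∃ A B : ℂ → ℂ, ∀ x y,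
    theta q r (x + y) * theta q r (x - y) = A x * B y - B x * A y := by
  obtain ⟨c, hc⟩ := theta_eq_jacobiTheta₂ hq hp
  have hτ := modulus_im_pos hq hp
  set L := Complex.log q with hL
  set τ := modulus q r with hmod
  set J := fun z => jacobiTheta₂ z (2 * τ) with hJ
  set e := fun x : ℂ => x * L / (Real.pi * Complex.I) with he
  refine ⟨fun x => c * Complex.exp (L * (2 * x ^ 2 / r - 2 * x)) * J (2 * e x - τ),
    fun x => c * Complex.exp (L * (2 * x ^ 2 / r)) * J (2 * e x), fun x y => ?_⟩
  have h := jacobiTheta₂_add_mul_sub hτ (e x + 1 / 2 - τ / 2) (e y)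
  have h1 : jacobiTheta₂ (2 * (e x + 1 / 2 - τ / 2)) (2 * τ) = J (2 * e x - τ) := by
    simp only [hJ]
    rw [← jacobiTheta₂_add_left (2 * e x - τ)]
    congr 1
    ring
  have h2 : jacobiTheta₂ (2 * (e x + 1 / 2 - τ / 2) + τ) (2 * τ) = J (2 * e x) := by
    simp only [hJ]
    rw [← jacobiTheta₂_add_left (2 * e x)]
    congr 1
    ring
  have h3 : jacobiTheta₂ (2 * e y + τ) (2 * τ) =
      Complex.exp (-(4 * Real.pi * Complex.I * e y)) * J (2 * e y - τ) := by
    simp only [hJ]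
    rw [show 2 * e y + τ = 2 * e y - τ + 2 * τ by ring, jacobiTheta₂_add_left']
    congr 2
    ring
  rw [h1, h2, h3] at h
  rw [hc, hc, show (x + y) * L / (Real.pi * Complex.I) + 1 / 2 - τ / 2 =
      e x + 1 / 2 - τ / 2 + e y by simp only [he]; ring,
    show (x - y) * L / (Real.pi * Complex.I) + 1 / 2 - τ / 2 =
      e x + 1 / 2 - τ / 2 - e y by simp only [he]; ring,
    mul_mul_mul_comm, h]
  have hex : ∀ x, Real.pi * Complex.I * e x = x * L := fun x => by
    simp only [he]
    field_simp [Complex.I_ne_zero]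
  have h4 : Complex.exp (2 * Real.pi * Complex.I * (e x + 1 / 2 - τ / 2 + e y) +
      Real.pi * Complex.I * τ) * Complex.exp (-(4 * Real.pi * Complex.I * e y)) =
      -(Complex.exp (2 * x * L) * Complex.exp (-(2 * y * L))) := by
    rw [← Complex.exp_add, ← Complex.exp_add, ← mul_neg_one (Complex.exp _),
      ← Complex.exp_pi_mul_I, ← Complex.exp_add]
    congr 1
    linear_combination 2 * hex x - 2 * hex y
  have h5 : Complex.exp (L * ((x + y) ^ 2 / r - (x + y))) *
      Complex.exp (L * ((x - y) ^ 2 / r - (x - y))) =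
      Complex.exp (L * (2 * x ^ 2 / r - 2 * x)) * Complex.exp (L * (2 * y ^ 2 / r)) := by
    rw [← Complex.exp_add, ← Complex.exp_add]
    congr 1
    ring
  have h6 : Complex.exp (L * (2 * x ^ 2 / r - 2 * x)) * Complex.exp (2 * x * L) =
      Complex.exp (L * (2 * x ^ 2 / r)) := by
    rw [← Complex.exp_add]
    congr 1
    ring
  have h7 : Complex.exp (L * (2 * y ^ 2 / r)) * Complex.exp (-(2 * y * L)) =
      Complex.exp (L * (2 * y ^ 2 / r - 2 * y)) := by
    rw [← Complex.exp_add]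
    congr 1
    ring
  linear_combination c ^ 2 * (J (2 * e x - τ) * J (2 * e y) +
      Complex.exp (2 * Real.pi * Complex.I * (e x + 1 / 2 - τ / 2 + e y) +
        Real.pi * Complex.I * τ) * Complex.exp (-(4 * Real.pi * Complex.I * e y)) *
        J (2 * e x) * J (2 * e y - τ)) * h5 +
    c ^ 2 * Complex.exp (L * (2 * x ^ 2 / r - 2 * x)) * Complex.exp (L * (2 * y ^ 2 / r)) *
      J (2 * e x) * J (2 * e y - τ) * h4 -
    c ^ 2 * J (2 * e x) * J (2 * e y - τ) *
      (Complex.exp (L * (2 * y ^ 2 / r)) * Complex.exp (-(2 * y * L)) * h6 +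
        Complex.exp (L * (2 * x ^ 2 / r)) * h7)

end

/-- The properties of the theta function that enter the argument. -/
structure IsThetaFunction (θ : ℂ → ℂ) : Prop where
  differentiable : Differentiable ℂ θ
  exists_ne_zero : ∃ x, θ x ≠ 0
  odd : ∀ x, θ (-x) = -θ x
  /-- the three-term relation of Weierstrass -/
  weierstrass : ∀ x y z w, θ (x + y) * θ (x - y) * (θ (z + w) * θ (z - w))
    - θ (x + z) * θ (x - z) * (θ (y + w) * θ (y - w))
    + θ (x + w) * θ (x - w) * (θ (y + z) * θ (y - z)) = 0
  /-- every zero is a quasi-period -/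
  quasiperiodic : ∀ η, θ η = 0 →
    ∃ α β : ℂ, ∀ x, θ (x + η) = Complex.exp (α * x + β) * θ x

lemma jacobiTheta₂_add_int (w τ : ℂ) (k : ℤ) : jacobiTheta₂ (w + k) τ = jacobiTheta₂ w τ := by
  induction k with
  | zero => simp
  | succ k ih => rw [← ih, ← jacobiTheta₂_add_left (w + (k : ℤ))]; congr 1; push_cast; ring
  | pred k ih => rw [← ih, ← jacobiTheta₂_add_left (w + _)]; congr 1; push_cast; ring

lemma jacobiTheta₂_add_nat_mul (τ : ℂ) (k : ℕ) : ∃ α β : ℂ, ∀ w,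
    jacobiTheta₂ (w + k * τ) τ = Complex.exp (α * w + β) * jacobiTheta₂ w τ := by
  induction k with
  | zero => exact ⟨0, 0, fun w => by simp⟩
  | succ k ih =>
    obtain ⟨α, β, h⟩ := ih
    refine ⟨α - 2 * Real.pi * Complex.I, β - Real.pi * Complex.I * (τ + 2 * (k * τ)), fun w => ?_⟩
    rw [show w + ((k + 1 : ℕ) : ℂ) * τ = w + k * τ + τ by push_cast; ring, jacobiTheta₂_add_left',
      h, ← mul_assoc, ← Complex.exp_add]
    congr 2
    ring

lemma jacobiTheta₂_add_int_mul (τ : ℂ) (k : ℤ) : ∃ α β : ℂ, ∀ w,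
    jacobiTheta₂ (w + k * τ) τ = Complex.exp (α * w + β) * jacobiTheta₂ w τ := by
  obtain ⟨m, rfl | rfl⟩ := k.eq_nat_or_neg
  · simpa using jacobiTheta₂_add_nat_mul τ m
  · obtain ⟨α, β, h⟩ := jacobiTheta₂_add_nat_mul τ m
    refine ⟨-α, α * (m * τ) - β, fun w => ?_⟩
    have h1 := h (w + ((-m : ℤ) : ℂ) * τ)
    rw [show w + ((-m : ℤ) : ℂ) * τ + m * τ = w by push_cast; ring] at h1
    rw [h1, ← mul_assoc, ← Complex.exp_add]
    convert (one_mul _).symm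
    rw [Complex.exp_eq_one_iff]
    exact ⟨0, by push_cast; ring⟩

section
variable {q r : ℂ}

/-- The zeros of `[u]` are the points `u` with `q^{2u} ∈ p^ℤ`. -/
lemma exists_int_of_theta_eq_zero (hq : q ≠ 0) (hp : ‖nome q r‖ < 1) (h1 : theta q r 1 ≠ 0)
    {u : ℂ} (hu : theta q r u = 0) :
    ∃ k m : ℤ, u * Complex.log q / (Real.pi * Complex.I) = k * modulus q r + m := by
  have hp0 : nome q r ≠ 0 := by rw [nome, Complex.cpow_def_of_ne_zero hq]; exact Complex.exp_ne_zero _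
  have hz0 : q ^ (2 * u) ≠ 0 := by rw [Complex.cpow_def_of_ne_zero hq]; exact Complex.exp_ne_zero _
  have hb : bigTheta (nome q r) (q ^ (2 * u)) = 0 := by
    rw [theta] at h1 hu
    have h2 := left_ne_zero_of_mul (left_ne_zero_of_mul h1)
    have h3 : q ^ (u ^ 2 / r - u) ≠ 0 := by
      rw [Complex.cpow_def_of_ne_zero hq]; exact Complex.exp_ne_zero _
    exact (mul_eq_zero.mp hu).resolve_left (mul_ne_zero h2 h3)
  obtain ⟨k, hk⟩ : ∃ k : ℤ, q ^ (2 * u) = nome q r ^ k := by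
    rw [bigTheta, mul_eq_zero, mul_eq_zero] at hb
    obtain (hb | hb) | hb := hb
    · obtain ⟨k, hk⟩ := exists_of_qProd_eq_zero hp hb
      exact ⟨-k, by rw [zpow_neg, zpow_natCast]; exact eq_inv_of_mul_eq_one_left hk⟩
    · obtain ⟨k, hk⟩ := exists_of_qProd_eq_zero hp hb
      refine ⟨k + 1, ?_⟩
      rw [zpow_add_one₀ hp0, zpow_natCast]
      rw [div_mul_eq_mul_div, div_eq_one_iff_eq hz0] at hk
      rw [← hk, mul_comm]
    · obtain ⟨k, hk⟩ := exists_of_qProd_eq_zero hp hb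
      exact absurd hk (fun h => one_sub_pow_ne_zero hp k (by rw [pow_succ', h, sub_self]))
  rw [nome, Complex.cpow_def_of_ne_zero hq, Complex.cpow_def_of_ne_zero hq, ← Complex.exp_int_mul,
    Complex.exp_eq_exp_iff_exists_int] at hk
  obtain ⟨m, hm⟩ := hk
  refine ⟨k, m, ?_⟩
  rw [modulus]
  field_simp [Complex.I_ne_zero]
  linear_combination hm / 2

lemma isThetaFunction_theta (hq : q ≠ 0) (hp : ‖nome q r‖ < 1) (h1 : theta q r 1 ≠ 0) :
    IsThetaFunction (theta q r) := by
  obtain ⟨A, B, hAB⟩ := theta_add_mul_theta_sub hq hp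
  refine ⟨differentiable_theta hq hp, ⟨1, h1⟩, fun x => ?_, fun x y z w => ?_, fun η hη => ?_⟩
  · -- the expression `[x + y] [x - y]` is antisymmetric in `x` and `y`
    have e1 := hAB ((1 + x) / 2) ((1 - x) / 2)
    have e2 := hAB ((1 - x) / 2) ((1 + x) / 2)
    rw [show (1 + x) / 2 + (1 - x) / 2 = 1 by ring, show (1 + x) / 2 - (1 - x) / 2 = x by ring] at e1
    rw [show (1 - x) / 2 + (1 + x) / 2 = 1 by ring, show (1 - x) / 2 - (1 + x) / 2 = -x by ring] at e2
    refine mul_left_cancel₀ h1 ?_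
    linear_combination e1 + e2
  · rw [hAB, hAB, hAB, hAB, hAB, hAB]
    ring
  · obtain ⟨k, m, hkm⟩ := exists_int_of_theta_eq_zero hq hp h1 hη
    obtain ⟨c, hc⟩ := theta_eq_jacobiTheta₂ hq hp
    obtain ⟨α, β, hJ⟩ := jacobiTheta₂_add_int_mul (modulus q r) k
    refine ⟨Complex.log q * (2 * η / r) + α * (Complex.log q / (Real.pi * Complex.I)),
      Complex.log q * (η ^ 2 / r - η) + α * (1 / 2 - modulus q r / 2) + β, fun x => ?_⟩
    have e : (x + η) * Complex.log q / (Real.pi * Complex.I) + 1 / 2 - modulus q r / 2 =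
        x * Complex.log q / (Real.pi * Complex.I) + 1 / 2 - modulus q r / 2 + k * modulus q r +
          m := by
      linear_combination hkm
    rw [hc, hc, e, jacobiTheta₂_add_int, hJ]
    set J := jacobiTheta₂ (x * Complex.log q / (Real.pi * Complex.I) + 1 / 2 - modulus q r / 2)
      (modulus q r)
    suffices Complex.exp (Complex.log q * ((x + η) ^ 2 / r - (x + η))) *
        Complex.exp (α * (x * Complex.log q / (Real.pi * Complex.I) + 1 / 2 - modulus q r / 2) + β) =
        Complex.exp ((Complex.log q * (2 * η / r) +
          α * (Complex.log q / (Real.pi * Complex.I))) * x +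
          (Complex.log q * (η ^ 2 / r - η) + α * (1 / 2 - modulus q r / 2) + β)) *
        Complex.exp (Complex.log q * (x ^ 2 / r - x)) by linear_combination c * J * this
    rw [← Complex.exp_add, ← Complex.exp_add]
    congr 1
    ring

end

namespace IsThetaFunction
variable {θ : ℂ → ℂ}

lemma map_zero (h : IsThetaFunction θ) : θ 0 = 0 := by
  have := h.odd 0
  rw [neg_zero] at this
  linear_combination this / 2

/-- The three-term relation with the arguments given up to rearrangement. -/
lemma three_term (h : IsThetaFunction θ) (x y z w : ℂ) {a₁ a₂ a₃ a₄ b₁ b₂ b₃ b₄ c₁ c₂ c₃ c₄ : ℂ}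
    (ha₁ : x + y = a₁ := by ring) (ha₂ : x - y = a₂ := by ring)
    (ha₃ : z + w = a₃ := by ring) (ha₄ : z - w = a₄ := by ring)
    (hb₁ : x + z = b₁ := by ring) (hb₂ : x - z = b₂ := by ring)
    (hb₃ : y + w = b₃ := by ring) (hb₄ : y - w = b₄ := by ring)
    (hc₁ : x + w = c₁ := by ring) (hc₂ : x - w = c₂ := by ring)
    (hc₃ : y + z = c₃ := by ring) (hc₄ : y - z = c₄ := by ring) :
    θ a₁ * θ a₂ * (θ a₃ * θ a₄) - θ b₁ * θ b₂ * (θ b₃ * θ b₄) + θ c₁ * θ c₂ * (θ c₃ * θ c₄) = 0 := by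
  subst_vars
  exact h.weierstrass x y z w

/-- The zeros of a theta function are closed under addition. -/
lemma add_eq_zero (h : IsThetaFunction θ) {x y : ℂ} (hx : θ x = 0) (hy : θ y = 0) :
    θ (x + y) = 0 := by
  obtain ⟨α, β, he⟩ := h.quasiperiodic y hy
  rw [he, hx, mul_zero]

lemma ne_zero_of_two_mul (h : IsThetaFunction θ) {x : ℂ} (hx : θ (2 * x) ≠ 0) : θ x ≠ 0 := by
  intro h0
  exact hx (by rw [two_mul]; exact h.add_eq_zero h0 h0)

end IsThetaFunction

/-! ### Codiscrete sets -/

lemma eventually_codiscrete_iff {P : ℂ → Prop} :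
    (∀ᶠ u in codiscrete ℂ, P u) ↔ ∀ x, ∀ᶠ u in nhdsWithin x {x}ᶜ, P u := by
  rw [Filter.Eventually, mem_codiscrete]
  simp only [disjoint_principal_right, compl_compl]
  rfl

lemma eventually_codiscrete_ne_zero {f : ℂ → ℂ} (hf : Differentiable ℂ f) {x : ℂ} (hx : f x ≠ 0) :
    ∀ᶠ u in codiscrete ℂ, f u ≠ 0 := by
  obtain h | h := AnalyticOnNhd.eqOn_zero_or_eventually_ne_zero_of_preconnected
    (fun z _ => (Complex.analyticAt_iff_eventually_differentiableAt.mpr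
      (Eventually.of_forall fun w => hf w) : AnalyticAt ℂ f z)) isPreconnected_univ
  · exact absurd (h (Set.mem_univ x)) hx
  · exact h

instance : (codiscrete ℂ).NeBot := by
  rw [neBot_iff]
  intro h
  have h1 : ∀ᶠ u in codiscrete ℂ, False := by rw [h]; exact mem_bot
  have h2 := eventually_codiscrete_iff.mp h1 0
  exact h2.exists.elim fun _ h => h

/-- Continuous functions that agree off a closed discrete set agree everywhere. -/
lemma eq_of_eventually_codiscrete {f g : ℂ → ℂ} (hf : Continuous f) (hg : Continuous g)
    (h : ∀ᶠ u in codiscrete ℂ, f u = g u) (x : ℂ) : f x = g x := by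
  have h1 := eventually_codiscrete_iff.mp h x
  exact tendsto_nhds_unique_of_eventuallyEq (l := nhdsWithin x {x}ᶜ)
    (hf.continuousAt.tendsto.mono_left nhdsWithin_le_nhds)
    (hg.continuousAt.tendsto.mono_left nhdsWithin_le_nhds) h1

lemma eventually_codiscrete_comp {P : ℂ → Prop} (h : ∀ᶠ u in codiscrete ℂ, P u) {f : ℂ → ℂ}
    (hf : Continuous f) (hinj : Function.Injective f) : ∀ᶠ u in codiscrete ℂ, P (f u) := by
  rw [eventually_codiscrete_iff] at h ⊢
  intro x
  refine Tendsto.eventually (f := f) ?_ (h (f x))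
  refine tendsto_nhdsWithin_iff.mpr
    ⟨hf.continuousAt.tendsto.mono_left nhdsWithin_le_nhds, ?_⟩
  filter_upwards [self_mem_nhdsWithin] with y hy
  exact fun h => hy (hinj h)

lemma eventually_codiscrete_add {P : ℂ → Prop} (h : ∀ᶠ u in codiscrete ℂ, P u) (c : ℂ) :
    ∀ᶠ u in codiscrete ℂ, P (c + u) :=
  eventually_codiscrete_comp h (by fun_prop) (add_right_injective c)

lemma eventually_codiscrete_sub {P : ℂ → Prop} (h : ∀ᶠ u in codiscrete ℂ, P u) (c : ℂ) :
    ∀ᶠ u in codiscrete ℂ, P (c - u) :=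
  eventually_codiscrete_comp h (by fun_prop) sub_right_injective

namespace IsThetaFunction
variable {θ : ℂ → ℂ}

lemma eventually_add_ne_zero (h : IsThetaFunction θ) (c : ℂ) :
    ∀ᶠ u in codiscrete ℂ, θ (c + u) ≠ 0 :=
  let ⟨_, hx⟩ := h.exists_ne_zero
  eventually_codiscrete_add (eventually_codiscrete_ne_zero h.differentiable hx) c

lemma eventually_sub_ne_zero (h : IsThetaFunction θ) (c : ℂ) :
    ∀ᶠ u in codiscrete ℂ, θ (c - u) ≠ 0 :=
  let ⟨_, hx⟩ := h.exists_ne_zero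
  eventually_codiscrete_sub (eventually_codiscrete_ne_zero h.differentiable hx) c

lemma eventually_ne_zero (h : IsThetaFunction θ) : ∀ᶠ u in codiscrete ℂ, θ u ≠ 0 :=
  let ⟨_, hx⟩ := h.exists_ne_zero
  eventually_codiscrete_ne_zero h.differentiable hx

end IsThetaFunction

/-! ### Weights of the vector representation -/

section
variable {n : ℕ} {g : AffType}

lemma mem_J_iff {μ : ℤ} : μ ∈ J g n ↔ -(n : ℤ) ≤ μ ∧ μ ≤ n ∧ (μ = 0 → g = .B) := by
  cases g <;> simp [J] <;> tauto

lemma neg_mem_J {μ : ℤ} (h : μ ∈ J g n) : -μ ∈ J g n := by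
  rw [mem_J_iff] at h ⊢
  refine ⟨by omega, by omega, fun h0 => h.2.2 (by omega)⟩

lemma succ_mem_J (i : Fin n) : (i : ℤ) + 1 ∈ J g n := by
  have := i.isLt
  rw [mem_J_iff]
  refine ⟨by omega, by omega, fun h => by omega⟩

lemma exists_index {μ : ℤ} (h : μ ∈ J g n) (h0 : μ ≠ 0) :
    ∃ i : Fin n, μ = i + 1 ∨ μ = -(i + 1) := by
  rw [mem_J_iff] at h
  refine ⟨⟨μ.natAbs - 1, by omega⟩, ?_⟩
  simp only
  omega

lemma hat_zero : (hat 0 : Fin n → ℤ) = 0 := by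
  funext i
  simp only [hat, Pi.zero_apply]
  rw [if_neg (by omega), if_neg (by omega)]

lemma hat_neg (μ : ℤ) : (hat (-μ) : Fin n → ℤ) = -hat μ := by
  funext i
  simp only [hat, Pi.neg_apply]
  split_ifs <;> first | rfl | omega

lemma hat_succ (i : Fin n) : (hat ((i : ℤ) + 1) : Fin n → ℤ) = Pi.single i 1 := by
  funext j
  simp only [hat, Pi.single_apply]
  have : (i : ℤ) + 1 = j + 1 ↔ j = i := by
    rw [Fin.ext_iff]
    omega
  simp only [this]
  split_ifs <;> first | rfl | omega

/-- The inner product of the weights `μ̂` and `ν̂`. -/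
def weightInner (μ ν : ℤ) : ℤ :=
  if μ = 0 then 0 else if μ = ν then 1 else if μ = -ν then -1 else 0

lemma hat_dotProduct_hat {μ ν : ℤ} (hμ : μ ∈ J g n) (hν : ν ∈ J g n) :
    (hat μ : Fin n → ℤ) ⬝ᵥ hat ν = weightInner μ ν := by
  unfold weightInner
  by_cases h0 : μ = 0
  · rw [if_pos h0, h0, hat_zero, zero_dotProduct]
  rw [if_neg h0]
  by_cases h0' : ν = 0
  · subst h0'
    rw [hat_zero, dotProduct_zero, if_neg h0, if_neg (by omega)]
  obtain ⟨i, rfl | rfl⟩ := exists_index hμ h0 <;> obtain ⟨j, rfl | rfl⟩ := exists_index hν h0' <;>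
    simp only [hat_neg, hat_succ, neg_dotProduct, dotProduct_neg, single_dotProduct,
      Pi.single_apply, one_mul, Fin.ext_iff] <;> split_ifs <;> omega

lemma hat_injOn : Set.InjOn (hat : ℤ → Fin n → ℤ) (J g n) := by
  intro μ hμ ν hν h
  have h1 := hat_dotProduct_hat hμ hν
  have h2 := hat_dotProduct_hat hμ hμ
  have h3 := hat_dotProduct_hat hν hν
  rw [h] at h1 h2
  simp only [weightInner] at h1 h2 h3
  split_ifs at h1 h2 h3 <;> omega

lemma mem_weights_iff {w : Fin n → ℤ} : w ∈ weights g n ↔ ∃ μ ∈ J g n, hat μ = w := by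
  simp [weights]

lemma hat_mem_weights {μ : ℤ} (h : μ ∈ J g n) : (hat μ : Fin n → ℤ) ∈ weights g n :=
  mem_weights_iff.mpr ⟨μ, h, rfl⟩

lemma neg_mem_weights {w : Fin n → ℤ} (h : w ∈ weights g n) : -w ∈ weights g n := by
  obtain ⟨μ, hμ, rfl⟩ := mem_weights_iff.mp h
  exact mem_weights_iff.mpr ⟨-μ, neg_mem_J hμ, hat_neg μ⟩

/-- The sum of two weights `γ̂`, `δ̂` that are neither zero nor proportional determines them: by the
inner product, no other weight can be subtracted within the set of weights. -/
lemma eq_or_eq_of_add_sub_mem_weights {α γ δ : ℤ} (hα : α ∈ J g n) (hγ : γ ∈ J g n)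
    (hδ : δ ∈ J g n) (hγ0 : γ ≠ 0) (hδ0 : δ ≠ 0) (h1 : γ ≠ δ) (h2 : γ ≠ -δ)
    (h : (hat γ + hat δ - hat α : Fin n → ℤ) ∈ weights g n) : α = γ ∨ α = δ := by
  obtain ⟨β, hβ, hw⟩ := mem_weights_iff.mp h
  have hββ := hat_dotProduct_hat hβ hβ
  rw [hw] at hββ
  simp only [add_dotProduct, sub_dotProduct, dotProduct_add, dotProduct_sub,
    hat_dotProduct_hat hα hα, hat_dotProduct_hat hα hγ, hat_dotProduct_hat hα hδ,
    hat_dotProduct_hat hγ hα, hat_dotProduct_hat hγ hγ, hat_dotProduct_hat hγ hδ,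
    hat_dotProduct_hat hδ hα, hat_dotProduct_hat hδ hγ, hat_dotProduct_hat hδ hδ] at hββ
  have hβ1 : weightInner β β ≤ 1 := by
    unfold weightInner
    split_ifs <;> omega
  have e1 : weightInner γ γ = 1 := by simp [weightInner, hγ0]
  have e2 : weightInner δ δ = 1 := by simp [weightInner, hδ0]
  have e3 : weightInner γ δ = 0 := by simp [weightInner, h1, h2]
  have e4 : weightInner δ γ = 0 := by
    simp only [weightInner]
    split_ifs <;> omega
  by_contra! hne
  have e5 : weightInner γ α ≤ 0 := by
    simp only [weightInner]
    split_ifs <;> omega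
  have e6 : weightInner δ α ≤ 0 := by
    simp only [weightInner]
    split_ifs <;> omega
  have e7 : weightInner α γ ≤ 0 := by
    simp only [weightInner]
    split_ifs <;> omega
  have e8 : weightInner α δ ≤ 0 := by
    simp only [weightInner]
    split_ifs <;> omega
  have e9 : 0 ≤ weightInner α α := by
    simp only [weightInner]
    split_ifs <;> omega
  omega

/-! ### Dynamical variables -/

variable {q r : ℂ} {lam : Fin n → ℂ}

lemma coord_zero (a : Fin n → ℤ) : coord g n lam a 0 = -(1 / 2) := by simp [coord]

lemma coord_eq_sum {μ : ℤ} (h : μ ≠ 0) (a : Fin n → ℤ) :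
    coord g n lam a μ = ∑ i, (lam i + a i + rho g n i) * (hat μ i : ℤ) := by
  rw [coord, if_neg h]

lemma coord_neg {μ : ℤ} (h : μ ≠ 0) (a : Fin n → ℤ) :
    coord g n lam a (-μ) = -coord g n lam a μ := by
  rw [coord_eq_sum h, coord_eq_sum (neg_ne_zero.mpr h), hat_neg, ← Finset.sum_neg_distrib]
  refine Finset.sum_congr rfl fun i _ => ?_
  rw [Pi.neg_apply]
  push_cast
  ring

lemma coord_succ (a : Fin n → ℤ) (i : Fin n) :
    coord g n lam a ((i : ℤ) + 1) = lam i + a i + rho g n i := by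
  rw [coord_eq_sum (by omega), hat_succ]
  simp [Pi.single_apply]

lemma coord_add_hat {μ ν : ℤ} (hμ : μ ∈ J g n) (hν : ν ∈ J g n) (a : Fin n → ℤ) :
    coord g n lam (a + hat ν) μ = coord g n lam a μ + weightInner ν μ := by
  by_cases h : μ = 0
  · subst h
    have : weightInner ν 0 = 0 := by
      simp only [weightInner]
      split_ifs <;> omega
    rw [coord_zero, coord_zero, this]
    simp
  · rw [coord_eq_sum h, coord_eq_sum h, ← hat_dotProduct_hat hν hμ, dotProduct, Int.cast_sum,
      ← Finset.sum_add_distrib]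
    refine Finset.sum_congr rfl fun i _ => ?_
    simp only [Pi.add_apply]
    push_cast
    ring

/-- The fractional part of the coordinates of `ρ`. -/
def AffType.shift : AffType → ℂ
  | .B => 1 / 2
  | .C => 0
  | .D => 0

lemma AffType.two_mul_shift (g : AffType) : ∃ d : ℤ, 2 * g.shift = d := by
  cases g
  · exact ⟨1, by simp [AffType.shift]⟩
  · exact ⟨0, by simp [AffType.shift]⟩
  · exact ⟨0, by simp [AffType.shift]⟩

lemma exists_rho_eq (i : Fin n) : ∃ k : ℤ, rho g n i = k + g.shift := by
  cases g
  · exact ⟨n - i - 1, by simp [rho, AffType.shift]; ring⟩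
  · exact ⟨n - i, by simp [rho, AffType.shift]⟩
  · exact ⟨n - i - 1, by simp [rho, AffType.shift]⟩

lemma exists_coord_eq {μ : ℤ} (hμ : μ ∈ J g n) (h0 : μ ≠ 0) (a : Fin n → ℤ) :
    ∃ i : Fin n, ∃ ε k : ℤ, (ε = 1 ∨ ε = -1) ∧ μ = ε * (i + 1) ∧
      coord g n lam a μ = ε * (lam i + k + g.shift) := by
  obtain ⟨i, hi⟩ := exists_index hμ h0
  obtain ⟨k, hk⟩ := exists_rho_eq (g := g) i
  obtain rfl | rfl := hi
  · refine ⟨i, 1, a i + k, Or.inl rfl, by ring, ?_⟩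
    rw [coord_succ, hk]
    push_cast
    ring
  · refine ⟨i, -1, a i + k, Or.inr rfl, by ring, ?_⟩
    rw [coord_neg (by omega), coord_succ, hk]
    push_cast
    ring

lemma IsThetaFunction.ne_zero_of_neg {θ : ℂ → ℂ} (h : IsThetaFunction θ) {x y : ℂ} (hx : θ x ≠ 0)
    (hxy : y = -x) : θ y ≠ 0 := by
  rw [hxy, h.odd]
  exact neg_ne_zero.mpr hx

lemma theta_two_mul_coord_ne_zero (hθ : IsThetaFunction (theta q r)) (hlam : Generic n q r lam)
    {μ : ℤ} (hμ : μ ∈ J g n) (h0 : μ ≠ 0) (a : Fin n → ℤ) (m : ℤ) :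
    theta q r (2 * coord g n lam a μ + m) ≠ 0 := by
  obtain ⟨i, ε, k, hε, -, hc⟩ := exists_coord_eq (lam := lam) hμ h0 a
  obtain ⟨d, hd⟩ := g.two_mul_shift
  rw [hc]
  obtain rfl | rfl := hε
  · have := (hlam (2 * k + d + m)).1 i
    convert this using 2
    push_cast
    linear_combination hd
  · refine hθ.ne_zero_of_neg ((hlam (2 * k + d - m)).1 i) ?_
    push_cast
    linear_combination -hd

lemma theta_coordSub_ne_zero (hθ : IsThetaFunction (theta q r)) (hlam : Generic n q r lam)
    {μ ν : ℤ} (hμ : μ ∈ J g n) (hν : ν ∈ J g n) (h1 : μ ≠ ν) (h2 : μ ≠ -ν) (a : Fin n → ℤ)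
    (m : ℤ) : theta q r (coord g n lam a μ - coord g n lam a ν + m) ≠ 0 := by
  -- for `B` the variable `a_0 = -1/2` is compared with a half-integral shift of `λ_i`
  have hzero : ∀ {κ : ℤ}, κ ∈ J g n → κ ≠ 0 → g = .B → ∀ m : ℤ,
      theta q r (coord g n lam a κ + 1 / 2 + m) ≠ 0 := by
    intro κ hκ hκ0 hB m
    refine hθ.ne_zero_of_two_mul ?_
    convert theta_two_mul_coord_ne_zero hθ hlam hκ hκ0 a (1 + 2 * m) using 2
    push_cast
    ring
  by_cases hμ0 : μ = 0
  · subst hμ0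
    refine hθ.ne_zero_of_neg (hzero hν (by omega) ((mem_J_iff.mp hμ).2.2 rfl) (-m)) ?_
    rw [coord_zero]
    push_cast
    ring
  by_cases hν0 : ν = 0
  · subst hν0
    convert hzero hμ hμ0 ((mem_J_iff.mp hν).2.2 rfl) m using 2
    rw [coord_zero]
    ring
  obtain ⟨i, ε, k, hε, hμi, hc⟩ := exists_coord_eq (lam := lam) hμ hμ0 a
  obtain ⟨j, ε', k', hε', hνj, hc'⟩ := exists_coord_eq (lam := lam) hν hν0 a
  obtain ⟨d, hd⟩ := g.two_mul_shift
  have hij : i ≠ j := by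
    rintro rfl
    obtain rfl | rfl := hε <;> obtain rfl | rfl := hε' <;> omega
  rw [hc, hc']
  obtain rfl | rfl := hε <;> obtain rfl | rfl := hε'
  · convert ((hlam (k - k' + m)).2 i j hij).1 using 2
    push_cast
    ring
  · convert ((hlam (k + k' + d + m)).2 i j hij).2 using 2
    push_cast
    linear_combination hd
  · refine hθ.ne_zero_of_neg ((hlam (k + k' + d - m)).2 i j hij).2 ?_
    push_cast
    linear_combination -hd
  · refine hθ.ne_zero_of_neg ((hlam (k - k' - m)).2 i j hij).1 ?_
    push_cast
    ring

lemma theta_coordAdd_ne_zero (hθ : IsThetaFunction (theta q r)) (hlam : Generic n q r lam)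
    {μ ν : ℤ} (hμ : μ ∈ J g n) (hν : ν ∈ J g n) (h1 : μ ≠ ν) (h2 : μ ≠ -ν) (a : Fin n → ℤ)
    (m : ℤ) : theta q r (coord g n lam a μ + coord g n lam a ν + m) ≠ 0 := by
  by_cases hν0 : ν = 0
  · subst hν0
    convert theta_coordSub_ne_zero hθ hlam hμ hν h1 h2 a (m - 1) using 2
    rw [coord_zero]
    push_cast
    ring
  · convert theta_coordSub_ne_zero hθ hlam hμ (neg_mem_J hν) h2 (by simpa using h1) a m using 2
    rw [coord_neg hν0]
    ring

lemma G_ne_zero (hθ : IsThetaFunction (theta q r)) (hlam : Generic n q r lam) (a : Fin n → ℤ) :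
    G g n q r lam a ≠ 0 := by
  rw [G]
  refine mul_ne_zero (mul_ne_zero ?_ ?_) ?_
  · refine zpow_ne_zero _ ?_
    cases g <;> simp [AffType.s]
  · refine Finset.prod_ne_zero_iff.mpr fun i _ => ?_
    have h := theta_two_mul_coord_ne_zero hθ hlam (succ_mem_J (g := g) i) (by omega) a 0
    rw [Int.cast_zero, add_zero] at h
    cases g
    · exact hθ.ne_zero_of_two_mul h
    · exact h
    · exact one_ne_zero
  · refine Finset.prod_ne_zero_iff.mpr fun i _ => Finset.prod_ne_zero_iff.mpr fun j hj => ?_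
    have hij : i < j := Finset.mem_Ioi.mp hj
    have h1 : (i : ℤ) + 1 ≠ j + 1 := by
      have := Fin.lt_def.mp hij
      omega
    have h2 : (i : ℤ) + 1 ≠ -(j + 1) := by omega
    have h3 := theta_coordSub_ne_zero hθ hlam (succ_mem_J (g := g) i) (succ_mem_J j) h1 h2 a 0
    have h4 := theta_coordAdd_ne_zero hθ hlam (succ_mem_J (g := g) i) (succ_mem_J j) h1 h2 a 0
    rw [Int.cast_zero, add_zero] at h3 h4
    exact mul_ne_zero h3 h4

end

/-! ### Weights determined by the crossing symmetry -/

/-- The standing hypotheses: a face weight with the weights of part (I) that satisfies the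
Yang–Baxter equation and the crossing symmetry. -/
structure IsFaceModel (g : AffType) (n : ℕ) (q r : ℂ) (lam : Fin n → ℂ)
    (rootG : (Fin n → ℤ) → ℂ) (rootT : (Fin n → ℤ) → ℤ → ℤ → ℂ) (κ : ℂ → ℂ)
    (W : (Fin n → ℤ) → (Fin n → ℤ) → (Fin n → ℤ) → (Fin n → ℤ) → ℂ → ℂ) : Prop where
  isTheta : IsThetaFunction (theta q r)
  theta_one : theta q r 1 ≠ 0
  generic : Generic n q r lam
  isRootG : IsRootG g n q r lam rootG
  isRootT : IsRootT g n q r lam rootT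
  isKappa : IsKappa g n q r κ
  partI : PartI g n q r lam rootT κ W
  ybe : YangBaxter g n W
  crossing : Crossing g n rootG W

namespace IsFaceModel
variable {g : AffType} {n : ℕ} {q r : ℂ} {lam : Fin n → ℂ} {rootG : (Fin n → ℤ) → ℂ}
  {rootT : (Fin n → ℤ) → ℤ → ℤ → ℂ} {κ : ℂ → ℂ}
  {W : (Fin n → ℤ) → (Fin n → ℤ) → (Fin n → ℤ) → (Fin n → ℤ) → ℂ → ℂ}

lemma rootG_ne_zero (H : IsFaceModel g n q r lam rootG rootT κ W) (a : Fin n → ℤ) :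
    rootG a ≠ 0 := by
  intro h
  have := H.isRootG a
  rw [h] at this
  exact G_ne_zero H.isTheta H.generic a (by rw [← this]; simp)

lemma Gratio_eq (H : IsFaceModel g n q r lam rootG rootT κ W) (a : Fin n → ℤ) (μ : ℤ) :
    Gratio g n q r lam a μ = (rootG (a + hat μ) / rootG a) ^ 2 := by
  rw [Gratio, ← H.isRootG, ← H.isRootG, div_pow]

lemma kappa_ne_zero (H : IsFaceModel g n q r lam rootG rootT κ W) :
    ∀ᶠ u in codiscrete ℂ, κ u ≠ 0 := by
  filter_upwards [H.isKappa.1] with u hu h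
  rw [h, zero_mul] at hu
  exact zero_ne_one hu

lemma kappa_crossing (H : IsFaceModel g n q r lam rootG rootT κ W) :
    ∀ᶠ u in codiscrete ℂ, κ (eta g n - u) =
      κ u * (theta q r u * theta q r (1 + eta g n - u) /
        (theta q r (1 + u) * theta q r (eta g n - u))) := by
  filter_upwards [H.isKappa.1, eventually_codiscrete_sub H.isKappa.2 0] with u h1 h2
  rw [show eta g n + (0 - u) = eta g n - u by ring, show -(0 - u) = u by ring,
    show 1 + eta g n + (0 - u) = 1 + eta g n - u by ring, show 1 - (0 - u) = 1 + u by ring,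
    zero_sub] at h2
  rw [← h2]
  linear_combination -κ (eta g n - u) * h1

lemma adm_add_hat {a b : Fin n → ℤ} {μ : ℤ} (hμ : μ ∈ J g n) (h : b = a + hat μ) :
    Adm g n a b := by
  rw [Adm, h, add_sub_cancel_left]
  exact hat_mem_weights hμ

lemma adm_sub_hat {a b : Fin n → ℤ} {μ : ℤ} (hμ : μ ∈ J g n) (h : b = a + hat μ) :
    Adm g n b a := by
  rw [Adm, h, sub_add_cancel_left]
  exact neg_mem_weights (hat_mem_weights hμ)

lemma coord_add_hat_neg {μ : ℤ} (hμ : μ ∈ J g n) (a : Fin n → ℤ) :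
    coord g n lam (a + hat μ) (-μ) = -coord g n lam a μ - 1 := by
  rw [coord_add_hat (neg_mem_J hμ) hμ]
  by_cases h : μ = 0
  · subst h
    rw [neg_zero, coord_zero]
    simp [weightInner]
    ring
  · rw [coord_neg h, show weightInner μ (-μ) = -1 by
      simp only [weightInner]; split_ifs <;> omega]
    push_cast
    ring

lemma coord_add_hat_of_ne {μ ν : ℤ} (hμ : μ ∈ J g n) (hν : ν ∈ J g n) (h1 : μ ≠ ν) (h2 : μ ≠ -ν)
    (a : Fin n → ℤ) : coord g n lam (a + hat ν) μ = coord g n lam a μ := by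
  rw [coord_add_hat hμ hν, show weightInner ν μ = 0 by
    simp only [weightInner]; split_ifs <;> omega]
  simp

/-- The weight of a face both of whose paths step back along `-λ̂` and then along `ν̂`. -/
lemma weight_return (H : IsFaceModel g n q r lam rootG rootT κ W) {l ν : ℤ} (hl : l ∈ J g n)
    (hν : ν ∈ J g n) (hne : l ≠ ν) (a : Fin n → ℤ) :
    ∀ᶠ u in codiscrete ℂ, W (a + hat l) a a (a + hat ν) u =
      κ u * (theta q r 1 * theta q r (coord g n lam a l + coord g n lam a ν + 1 + u) /
        (theta q r (1 + u) * theta q r (coord g n lam a l + coord g n lam a ν + 1))) := by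
  have ha : a + hat l + hat (-l) = a := by rw [hat_neg]; abel
  by_cases h : l = -ν
  · subst h
    have h0 : ν ≠ 0 := by omega
    have h1 := H.partI.1 (a + hat (-ν)) (- -ν) (neg_mem_J (neg_mem_J hν)) (by simpa)
    rw [ha, neg_neg] at h1
    filter_upwards [h1, H.isTheta.eventually_add_ne_zero 1] with u h1 h2
    rw [h1, coord_neg h0, neg_add_cancel, zero_add]
    congr 1
    have := H.theta_one
    field_simp
  · have h1 := H.partI.2.1 (a + hat l) (-l) (neg_mem_J hl) ν hν (by omega) (by omega)
    rw [ha, coordSub, coord_add_hat_neg hl, coord_add_hat_of_ne hν hl (by omega) (by omega)] at h1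
    filter_upwards [h1] with u h1
    rw [h1, show -coord g n lam a l - 1 - coord g n lam a ν - u =
        -(coord g n lam a l + coord g n lam a ν + 1 + u) by ring,
      show -coord g n lam a l - 1 - coord g n lam a ν =
        -(coord g n lam a l + coord g n lam a ν + 1) by ring, H.isTheta.odd, H.isTheta.odd]
    congr 1
    rw [mul_neg, mul_neg, neg_div_neg_eq]

/-- The weights of part (II) off the diagonal: the crossing symmetry reduces them to weights of
part (I). -/
lemma weight_offDiagonal (H : IsFaceModel g n q r lam rootG rootT κ W) {μ ν : ℤ} (hμ : μ ∈ J g n)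
    (hν : ν ∈ J g n) (hne : μ ≠ ν) (a : Fin n → ℤ) :
    ∀ᶠ u in codiscrete ℂ, W a (a + hat ν) (a + hat μ) a u =
      κ u * (theta q r u * theta q r 1 *
          theta q r (coord g n lam a μ + coord g n lam a ν + 1 + eta g n - u)
        / (theta q r (eta g n - u) * theta q r (1 + u)
            * theta q r (coord g n lam a μ + coord g n lam a ν + 1))
        * (rootG (a + hat μ) / rootG a * (rootG (a + hat ν) / rootG a))) := by
  filter_upwards [H.crossing a (a + hat ν) (a + hat μ) a (adm_add_hat hν rfl) (adm_sub_hat hν rfl)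
      (adm_add_hat hμ rfl) (adm_sub_hat hμ rfl),
    eventually_codiscrete_sub (H.weight_return hμ hν hne a) (eta g n), H.kappa_crossing,
    H.isTheta.eventually_sub_ne_zero (1 + eta g n), H.isTheta.eventually_sub_ne_zero (eta g n),
    H.isTheta.eventually_add_ne_zero 1]
    with u h1 h2 h3 h4 h5 h6
  have e : coord g n lam a μ + coord g n lam a ν + 1 + (eta g n - u) =
    coord g n lam a μ + coord g n lam a ν + 1 + eta g n - u := by ring
  have e' : 1 + (eta g n - u) = 1 + eta g n - u := by ring
  rw [h1, h2, h3, e, e']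
  field_simp

/-- The weight of a face in which the two steps are interchanged, with an arbitrary naming of the
corners. -/
lemma weight_swap (H : IsFaceModel g n q r lam rootG rootT κ W) {μ ν : ℤ} (hμ : μ ∈ J g n)
    (hν : ν ∈ J g n) (h1 : μ ≠ ν) (h2 : μ ≠ -ν) {a b c d : Fin n → ℤ} (hb : b = a + hat ν)
    (hc : c = a + hat μ) (hd : d = a + hat μ + hat ν) {x : ℂ}
    (hx : coord g n lam a μ - coord g n lam a ν = x) :
    ∀ᶠ u in codiscrete ℂ, W a b c d u =
      κ u * (theta q r u * rootT a μ ν / (theta q r (1 + u) * theta q r x)) := by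
  subst hb hc hd hx
  exact H.partI.2.2 a μ hμ ν hν h1 h2

lemma weight_straight (H : IsFaceModel g n q r lam rootG rootT κ W) {μ ν : ℤ} (hμ : μ ∈ J g n)
    (hν : ν ∈ J g n) (h1 : μ ≠ ν) (h2 : μ ≠ -ν) {a b c d : Fin n → ℤ} (hb : b = a + hat μ)
    (hc : c = a + hat μ) (hd : d = a + hat μ + hat ν) {x : ℂ}
    (hx : coord g n lam a μ - coord g n lam a ν = x) :
    ∀ᶠ u in codiscrete ℂ, W a b c d u =
      κ u * (theta q r 1 * theta q r (x - u) / (theta q r (1 + u) * theta q r x)) := by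
  subst hb hc hd hx
  exact H.partI.2.1 a μ hμ ν hν h1 h2

/-- The crossing symmetry ties the signs of the square roots together. -/
lemma rootT_eq (H : IsFaceModel g n q r lam rootG rootT κ W) {μ ν : ℤ} (hμ : μ ∈ J g n)
    (hν : ν ∈ J g n) (h1 : μ ≠ ν) (h2 : μ ≠ -ν) (a : Fin n → ℤ) :
    rootT a ν μ = theta q r (coord g n lam a ν - coord g n lam a μ) *
      (rootG (a + hat ν) * rootG (a + hat μ) / (rootG a * rootG (a + hat ν + hat μ))) *
      rootT (a + hat ν) μ (-ν) / theta q r (coord g n lam a μ + coord g n lam a ν + 1) := by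
  have hc : coord g n lam (a + hat ν) μ - coord g n lam (a + hat ν) (-ν) =
      coord g n lam a μ + coord g n lam a ν + 1 := by
    rw [coord_add_hat_of_ne hμ hν h1 h2, coord_add_hat_neg hν]
    ring
  have s1 := H.weight_swap (μ := ν) (ν := μ) hν hμ (by omega) (by omega) (a := a) rfl rfl rfl rfl
  have s2 := H.weight_swap (μ := μ) (ν := -ν) hμ (neg_mem_J hν) h2 (by omega)
    (a := a + hat ν) (b := a) (c := a + hat ν + hat μ) (d := a + hat μ)
    (by rw [hat_neg]; abel) rfl (by rw [hat_neg]; abel) hc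
  have hD := theta_coordSub_ne_zero H.isTheta H.generic hν hμ (by omega) (by omega) a 0
  rw [Int.cast_zero, add_zero] at hD
  have hM := theta_coordAdd_ne_zero H.isTheta H.generic hμ hν h1 h2 a 1
  rw [Int.cast_one] at hM
  have hcr := H.crossing a (a + hat μ) (a + hat ν) (a + hat ν + hat μ) (adm_add_hat hμ rfl)
    (adm_add_hat hν (by abel)) (adm_add_hat hν rfl) (adm_add_hat hμ rfl)
  obtain ⟨u, s1, s2, hcr, hk, hk0, t1, t2, t3, t4⟩ := (s1.and <| (eventually_codiscrete_sub s2
    (eta g n)).and <| hcr.and <| H.kappa_crossing.and <| H.kappa_ne_zero.and <|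
    (H.isTheta.eventually_sub_ne_zero (1 + eta g n)).and <|
    (H.isTheta.eventually_sub_ne_zero (eta g n)).and <|
    (H.isTheta.eventually_add_ne_zero 1).and <| H.isTheta.eventually_ne_zero).exists
  rw [s1, s2, hk, show 1 + (eta g n - u) = 1 + eta g n - u by ring] at hcr
  field_simp at hcr ⊢
  linear_combination hcr

end IsFaceModel

/-! ### Diagonal weights with nonzero step -/

/-- A relation `F(u) [α - u - v] = H(v) [β - u - v]` with `[β - α] ≠ 0` forces `F = 0`: the left
side has its zero in `v` at a place that depends on `u`, unlike the right side. -/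
lemma IsThetaFunction.eventually_eq_zero {θ F K : ℂ → ℂ} (h : IsThetaFunction θ) {α β : ℂ}
    (hαβ : θ (β - α) ≠ 0)
    (hF : ∀ᶠ u in codiscrete ℂ, ∀ᶠ v in codiscrete ℂ,
      F u * θ (α - u - v) = K v * θ (β - u - v)) :
    ∀ᶠ u in codiscrete ℂ, F u = 0 := by
  filter_upwards [hF] with u hu
  obtain ⟨w, hw, hne⟩ := (hF.and (eventually_codiscrete_comp h.eventually_ne_zero
    (f := fun w => w - u) (by fun_prop) sub_left_injective)).exists
  have hc := h.differentiable.continuous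
  have key : ∀ v, F u * θ (α - u - v) * θ (β - w - v) = F w * θ (α - w - v) * θ (β - u - v) := by
    refine eq_of_eventually_codiscrete (by fun_prop) (by fun_prop) ?_
    filter_upwards [hu, hw] with v h1 h2
    rw [h1, h2]
    ring
  have := key (α - w)
  rw [sub_self, h.map_zero, mul_zero, zero_mul, show α - u - (α - w) = w - u by ring,
    show β - w - (α - w) = β - α by ring] at this
  simpa [hαβ, hne] using this

/-- The scalar form of the Yang–Baxter equation `ybe_reflect`: the deviations of the two unknown
weights from their expected values are proportional.  `w₁` and `w₂` are instances of the three-term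
relation. -/
lemma reflect_deviation {A B C A' B' C' A'' B'' C'' o M D Q P a₁ a₂ a₃ a₄ X₀ b₁ b₂ b₃ b₄ k k' k''
    T₁ T₂ e em en emn X X' : ℂ} (hA : A ≠ 0) (hB : B ≠ 0) (hC : C ≠ 0) (hA' : A' ≠ 0)
    (hB' : B' ≠ 0) (hC' : C' ≠ 0) (hA'' : A'' ≠ 0) (hB'' : B'' ≠ 0) (hC'' : C'' ≠ 0) (ho : o ≠ 0)
    (hM : M ≠ 0) (hD : D ≠ 0) (hX₀ : X₀ ≠ 0) (hk : k ≠ 0) (hk' : k' ≠ 0) (hk'' : k'' ≠ 0)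
    (hT₂ : T₂ ≠ 0) (he : e ≠ 0) (hem : em ≠ 0) (hen : en ≠ 0) (hemn : emn ≠ 0)
    (hT₁ : T₁ = D * (en * em / (e * emn)) * T₂ / M)
    (w₁ : a₂ * a₁ * C'' * X₀ + b₄ * A * Q * D = b₁ * P * M * C')
    (w₂ : b₃ * Q * C * D = a₃ * a₄ * X₀ * C'' + b₂ * P * A' * M)
    (h : k * (A * T₂ / (B * M)) * (k'' * (A'' * o * Q / (C'' * B'' * M) * (en / e * (em / e)))) * X'
        + k * (o * a₁ / (B * M)) * (k'' * (A'' * T₁ / (B'' * D))) *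
          (k' * (A' * o * a₂ / (C' * B' * D) * (emn / em * (e / em)))) =
      k * (A * o * a₃ / (C * B * M) * (en / e * (em / e))) * (k'' * (A'' * T₂ / (B'' * M))) *
          (k' * (o * a₄ / (B' * D))) +
        X * (k'' * (A'' * o * P / (C'' * B'' * D) * (emn / em * (e / em)))) *
          (k' * (A' * T₁ / (B' * D)))) :
    (X / k - (o / (B * X₀) * (b₁ + A * b₂ / C * (em / e) ^ 2))) * B / A *
        (M / (D * (em / e) ^ 2)) * P =
      (X' / k' - (o / (B' * X₀) * (b₃ + A' * b₄ / C' / (em / e) ^ 2))) * B' / A' * Q := by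
  obtain ⟨x, rfl⟩ : ∃ x, X = k * x := ⟨X / k, by field_simp⟩
  obtain ⟨x', rfl⟩ : ∃ x, X' = k' * x := ⟨X' / k', by field_simp⟩
  set G := em ^ 2 / e ^ 2 with hG
  have hcommon : k * k' * k'' * A'' * o * T₂ * em * en /
      (B'' * M * e ^ 2 * (B * B' * C * C' * C'' * D * M * G)) ≠ 0 := by
    have : B'' * M * e ^ 2 * (B * B' * C * C' * C'' * D * M * G) ≠ 0 := by positivity
    positivity
  have E : A * Q * x' * B' * C * C' * D * G + o * a₁ * a₂ * A' * C * C'' =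
      o * A * a₃ * a₄ * C' * C'' * G + x * P * A' * M * B * C * C' := by
    refine mul_left_cancel₀ hcommon ?_
    rw [hT₁] at h
    refine Eq.trans ?_ (h.trans ?_)
    · rw [hG]
      field_simp
    · rw [hG]
      field_simp
  have cleared : (x * B * X₀ * C - o * (b₁ * C + A * b₂ * G)) * M * P * A' * C' =
      (x' * B' * X₀ * C' * G - o * (b₃ * C' * G + A' * b₄)) * Q * A * D * C := by
    linear_combination -X₀ * E + o * A' * C * w₁ + o * A * C' * G * w₂
  have hL : (k * x / k - (o / (B * X₀) * (b₁ + A * b₂ / C * (em / e) ^ 2))) * B / A *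
        (M / (D * (em / e) ^ 2)) * P =
      (x * B * X₀ * C - o * (b₁ * C + A * b₂ * G)) * M * P * A' * C' /
        (A * A' * D * G * X₀ * C * C') := by
    rw [hG]
    field_simp
  have hR : (k' * x' / k' - (o / (B' * X₀) * (b₃ + A' * b₄ / C' / (em / e) ^ 2))) * B' / A' * Q =
      (x' * B' * X₀ * C' * G - o * (b₃ * C' * G + A' * b₄)) * Q * A * D * C /
        (A * A' * D * G * X₀ * C * C') := by
    rw [hG]
    field_simp
  rw [hL, hR, cleared]

namespace IsFaceModel
variable {g : AffType} {n : ℕ} {q r : ℂ} {lam : Fin n → ℂ} {rootG : (Fin n → ℤ) → ℂ}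
  {rootT : (Fin n → ℤ) → ℤ → ℤ → ℂ} {κ : ℂ → ℂ}
  {W : (Fin n → ℤ) → (Fin n → ℤ) → (Fin n → ℤ) → (Fin n → ℤ) → ℂ → ℂ}

/-- An instance of the Yang–Baxter equation with two heights on each side.  The only weights in it
that are not yet known are the diagonal weight at `a` and the one at `a + μ̂`, and they occur once
each, in different spectral parameters. -/
lemma ybe_reflect (H : IsFaceModel g n q r lam rootG rootT κ W) {μ ν : ℤ} (hμ : μ ∈ J g n)
    (hν : ν ∈ J g n) (hμ0 : μ ≠ 0) (hν0 : ν ≠ 0) (h1 : μ ≠ ν) (h2 : μ ≠ -ν) (a : Fin n → ℤ) :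
    ∀ᶠ u in codiscrete ℂ, ∀ᶠ v in codiscrete ℂ,
      W (a + hat ν) a (a + hat ν + hat μ) (a + hat μ) u *
          W a (a + hat μ) (a + hat ν) a (u + v) * W (a + hat μ) a a (a + hat μ) v +
        W (a + hat ν) (a + hat ν + hat μ) (a + hat ν + hat μ) (a + hat μ) u *
          W a (a + hat μ) (a + hat ν) (a + hat ν + hat μ) (u + v) *
          W (a + hat μ) a (a + hat ν + hat μ) (a + hat μ) v =
      W a (a + hat μ) (a + hat ν) a u *
          W (a + hat ν) a (a + hat ν + hat μ) (a + hat μ) (u + v) *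
          W a (a + hat ν) (a + hat ν) (a + hat ν + hat μ) v +
        W a (a + hat μ) (a + hat μ) a u *
          W (a + hat μ) a (a + hat ν + hat μ) (a + hat μ) (u + v) *
          W a (a + hat μ) (a + hat ν) (a + hat ν + hat μ) v := by
  have h := H.ybe a (a + hat μ) a (a + hat μ) (a + hat ν + hat μ) (a + hat ν)
    (adm_add_hat hμ rfl) (adm_sub_hat hμ rfl) (adm_add_hat hμ rfl) (adm_add_hat hν rfl)
    (adm_add_hat hμ rfl) (adm_sub_hat hν (by abel))
  have hL : ((weights g n).image (a + hat μ + ·)).filter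
      (fun x => Adm g n (a + hat ν) x ∧ Adm g n x (a + hat μ)) = {a, a + hat ν + hat μ} := by
    ext x
    simp only [Finset.mem_filter, Finset.mem_image, Finset.mem_insert, Finset.mem_singleton]
    constructor
    · rintro ⟨-, hx1, hx2⟩
      obtain ⟨σ, hσ, hσx⟩ := mem_weights_iff.mp hx2
      have hx : x = a + hat μ - hat σ := by rw [hσx]; abel
      subst hx
      rw [Adm, show a + hat μ - hat σ - (a + hat ν) = hat μ + hat (-ν) - hat σ by
        rw [hat_neg]; abel] at hx1
      obtain rfl | rfl := eq_or_eq_of_add_sub_mem_weights hσ hμ (neg_mem_J hν) hμ0 (by omega) h2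
        (by omega) hx1
      · left; abel
      · right; rw [hat_neg]; abel
    · rintro (rfl | rfl)
      · exact ⟨⟨-hat μ, neg_mem_weights (hat_mem_weights hμ), by abel⟩, adm_sub_hat hν rfl,
          adm_add_hat hμ rfl⟩
      · exact ⟨⟨hat ν, hat_mem_weights hν, by abel⟩, adm_add_hat hμ rfl, adm_sub_hat hν (by abel)⟩
  have hR : ((weights g n).image (a + ·)).filter
      (fun x => Adm g n x a ∧ Adm g n x (a + hat ν + hat μ)) = {a + hat ν, a + hat μ} := by
    ext x
    simp only [Finset.mem_filter, Finset.mem_image, Finset.mem_insert, Finset.mem_singleton]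
    constructor
    · rintro ⟨⟨w, hw, rfl⟩, -, hx⟩
      obtain ⟨σ, hσ, rfl⟩ := mem_weights_iff.mp hw
      rw [Adm, show a + hat ν + hat μ - (a + hat σ) = hat μ + hat ν - hat σ by abel] at hx
      obtain rfl | rfl := eq_or_eq_of_add_sub_mem_weights hσ hμ hν hμ0 hν0 h1 h2 hx
      · right; rfl
      · left; rfl
    · rintro (rfl | rfl)
      · exact ⟨⟨_, hat_mem_weights hν, rfl⟩, adm_sub_hat hν rfl, adm_add_hat hμ rfl⟩
      · exact ⟨⟨_, hat_mem_weights hμ, rfl⟩, adm_sub_hat hμ rfl, adm_add_hat hν (by abel)⟩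
  have hne1 : a ≠ a + hat ν + hat μ := by
    intro h0
    have : (hat μ : Fin n → ℤ) = hat (-ν) := by
      rw [hat_neg]
      have h3 : a + 0 = a + (hat ν + hat μ) := by rw [add_zero, ← add_assoc]; exact h0
      exact eq_neg_of_add_eq_zero_right (add_left_cancel h3).symm
    exact h2 (hat_injOn hμ (neg_mem_J hν) this)
  have hne2 : a + hat ν ≠ a + hat μ := fun h0 =>
    h1 (hat_injOn hν hμ (add_left_cancel h0)).symm
  filter_upwards [h] with u hu
  filter_upwards [hu] with v hv
  rwa [hL, hR, Finset.sum_pair hne1, Finset.sum_pair hne2] at hv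

/-- The diagonal weight `W(a, a + μ̂; a + μ̂, a)` with `μ ≠ 0`, without the sum over `J`. -/
lemma weight_diagonal (H : IsFaceModel g n q r lam rootG rootT κ W) {μ ν : ℤ} (hμ : μ ∈ J g n)
    (hν : ν ∈ J g n) (hμ0 : μ ≠ 0) (hν0 : ν ≠ 0) (h1 : μ ≠ ν) (h2 : μ ≠ -ν) (a : Fin n → ℤ) :
    ∀ᶠ u in codiscrete ℂ, W a (a + hat μ) (a + hat μ) a u =
      κ u * (theta q r 1 / (theta q r (1 + u) * theta q r (2 * coord g n lam a μ + 1)) *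
        (theta q r (2 * coord g n lam a μ + 1 - u) +
          theta q r u * theta q r (2 * coord g n lam a μ + 1 + eta g n - u) /
            theta q r (eta g n - u) * (rootG (a + hat μ) / rootG a) ^ 2)) := by
  have hθ := H.isTheta
  set θ := theta q r with hθdef
  set m := coord g n lam a μ with hm
  set k := coord g n lam a ν with hk
  set η := eta g n with hη
  have hM : θ (m + k + 1) ≠ 0 := by
    have := theta_coordAdd_ne_zero hθ H.generic hμ hν h1 h2 a 1
    rwa [Int.cast_one] at this
  have hD : θ (k - m) ≠ 0 := by
    have := theta_coordSub_ne_zero hθ H.generic hν hμ (by omega) (by omega) a 0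
    rwa [Int.cast_zero, add_zero] at this
  have hX : θ (2 * m + 1) ≠ 0 := by
    have := theta_two_mul_coord_ne_zero hθ H.generic hμ hμ0 a 1
    rwa [Int.cast_one] at this
  have hT2 : rootT (a + hat ν) μ (-ν) ≠ 0 := by
    have e := H.isRootT (a + hat ν) μ hμ (-ν) (neg_mem_J hν) h2 (by omega)
    rw [coordSub, coord_add_hat_neg hν, coord_add_hat_of_ne hμ hν h1 h2] at e
    intro h0
    rw [h0, zero_pow two_ne_zero, eq_comm, mul_eq_zero] at e
    obtain e | e := e
    · refine theta_coordAdd_ne_zero hθ H.generic hμ hν h1 h2 a 2 ?_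
      rw [← e]
      congr 1
      push_cast
      ring
    · refine theta_coordAdd_ne_zero hθ H.generic hμ hν h1 h2 a 0 ?_
      rw [← e]
      congr 1
      push_cast
      ring
  have hT1 := H.rootT_eq hμ hν h1 h2 a
  rw [← hθdef, ← hm, ← hk] at hT1
  have ra := H.rootG_ne_zero a
  have rm := H.rootG_ne_zero (a + hat μ)
  have rn := H.rootG_ne_zero (a + hat ν)
  have rmn := H.rootG_ne_zero (a + hat ν + hat μ)
  have hneg : a + hat ν + hat (-ν) = a := by rw [hat_neg]; abel
  have hneg' : a + hat μ + hat (-μ) = a := by rw [hat_neg]; abel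
  -- the six known weights
  have S1 := H.weight_swap (μ := μ) (ν := -ν) hμ (neg_mem_J hν) h2 (by omega)
    (a := a + hat ν) (b := a) (c := a + hat ν + hat μ) (d := a + hat μ) hneg.symm rfl
    (by rw [hat_neg]; abel) (x := m + k + 1)
    (by rw [coord_add_hat_of_ne hμ hν h1 h2, coord_add_hat_neg hν]; ring)
  have S2 := H.weight_swap (μ := ν) (ν := μ) hν hμ (by omega) (by omega) (a := a) rfl rfl rfl rfl
  have O1 := H.weight_offDiagonal hν hμ (by omega) a
  have O2 := H.weight_offDiagonal (μ := ν) (ν := -μ) hν (neg_mem_J hμ) (by omega)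
    (a + hat μ)
  rw [hneg', show a + hat μ + hat ν = a + hat ν + hat μ by abel,
    coord_add_hat_of_ne hν hμ (by omega) (by omega), coord_add_hat_neg hμ] at O2
  have D1 := H.weight_straight (μ := μ) (ν := -ν) hμ (neg_mem_J hν) h2 (by omega)
    (a := a + hat ν) (b := a + hat ν + hat μ) (c := a + hat ν + hat μ) (d := a + hat μ) rfl rfl
    (by rw [hat_neg]; abel) (x := m + k + 1)
    (by rw [coord_add_hat_of_ne hμ hν h1 h2, coord_add_hat_neg hν]; ring)
  have D2 := H.weight_straight (μ := ν) (ν := μ) hν hμ (by omega) (by omega) (a := a) rfl rfl rfl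
    rfl
  rw [← hθdef, ← hm, ← hk] at S2 O1 O2 D2
  rw [← hθdef] at S1 D1
  rw [← hη] at O1 O2
  set T2 := rootT (a + hat ν) μ (-ν)
  set e := rootG a
  set em := rootG (a + hat μ)
  set en := rootG (a + hat ν)
  set emn := rootG (a + hat ν + hat μ)
  -- `F` and `K` are, up to explicit factors, the deviations of the two unknown weights from the
  -- expected values
  set F : ℂ → ℂ := fun u => (W a (a + hat μ) (a + hat μ) a u / κ u -
    (θ 1 / (θ (1 + u) * θ (2 * m + 1)) * (θ (2 * m + 1 - u) +
      θ u * θ (2 * m + 1 + η - u) / θ (η - u) * (em / e) ^ 2))) * θ (1 + u) / θ u *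
    (θ (m + k + 1) / (θ (k - m) * (em / e) ^ 2)) with hF
  set K : ℂ → ℂ := fun v => (W (a + hat μ) a a (a + hat μ) v / κ v -
    (θ 1 / (θ (1 + v) * θ (2 * m + 1)) * (θ (2 * m + 1 + v) +
      θ v * θ (2 * m + 1 - η + v) / θ (η - v) / (em / e) ^ 2))) * θ (1 + v) / θ v with hK
  have key : ∀ᶠ u in codiscrete ℂ, F u = 0 := by
    refine hθ.eventually_eq_zero (K := K) (α := k - m + η) (β := m + k + 1 + η)
      (by rwa [show m + k + 1 + η - (k - m + η) = 2 * m + 1 by ring]) ?_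
    filter_upwards [H.ybe_reflect hμ hν hμ0 hν0 h1 h2 a, S1, O1, D1, H.kappa_ne_zero,
      hθ.eventually_add_ne_zero 1, hθ.eventually_ne_zero, hθ.eventually_sub_ne_zero η]
      with u hu s1 o1 d1 k1 t1 t2 t3
    filter_upwards [hu, eventually_codiscrete_add S1 u, eventually_codiscrete_add S2 u,
      eventually_codiscrete_add O1 u, eventually_codiscrete_add O2 u, O2, S2, D2, H.kappa_ne_zero,
      eventually_codiscrete_add H.kappa_ne_zero u, hθ.eventually_add_ne_zero 1,
      hθ.eventually_ne_zero, hθ.eventually_sub_ne_zero η,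
      hθ.eventually_add_ne_zero (1 + u), hθ.eventually_add_ne_zero u,
      hθ.eventually_sub_ne_zero (η - u)]
      with v hv s1' s2' o1' o2' o2 s2 d2 k2 k3 t4 t5 t6 t7 t8 t9
    rw [s1, o1', o1, s1', s2', o2', o2, s2, d1, d2] at hv
    have w₁ := hθ.three_term ((2 * k + 1 + η - u - v) / 2) ((η - v - 2 * m - 1 + u) / 2)
      ((2 * m + 1 + η - u - v) / 2) ((2 * m + 1 - η + u + v) / 2)
      (a₁ := k - m + η - v) (a₂ := m + k + 1 - u) (a₃ := 2 * m + 1) (a₄ := η - u - v)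
      (b₁ := m + k + 1 + η - u - v) (b₂ := k - m) (b₃ := u) (b₄ := -(2 * m + 1 - η + v))
      (c₁ := m + k + 1) (c₂ := k - m + η - u - v) (c₃ := η - v) (c₄ := -(2 * m + 1 - u))
    have w₂ := hθ.three_term ((3 * m + k + 2 + η - u) / 2) ((m - k + 2 * v - η + u) / 2)
      ((η - u + k - m) / 2) ((η - u - k + m) / 2)
      (a₁ := 2 * m + 1 + v) (a₂ := m + k + 1 + η - u - v) (a₃ := η - u) (a₄ := k - m)
      (b₁ := m + k + 1 + η - u) (b₂ := 2 * m + 1) (b₃ := -(k - m - v)) (b₄ := -(η - u - v))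
      (c₁ := 2 * m + 1 + η - u) (c₂ := m + k + 1) (c₃ := v) (c₄ := -(k - m + η - u - v))
    simp only [hθ.odd] at w₁ w₂
    refine reflect_deviation t2 t1 t3 t5 t4 t6 t8 t7 t9 H.theta_one hM hD hX k1 k2 k3 hT2 ra rm rn
      rmn hT1 (a₁ := θ (m + k + 1 - u)) (a₂ := θ (k - m + η - v)) (a₃ := θ (m + k + 1 + η - u))
      (a₄ := θ (k - m - v)) ?_ ?_ ?_
    · linear_combination w₁
    · linear_combination w₂
    · refine Eq.trans (Eq.trans ?_ hv) ?_
      · ring_nf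
      · ring_nf
  filter_upwards [key, H.kappa_ne_zero, hθ.eventually_add_ne_zero 1, hθ.eventually_ne_zero]
    with u hu k1 t1 t2
  simp only [hF] at hu
  have h3 : θ (m + k + 1) / (θ (k - m) * (em / e) ^ 2) ≠ 0 := by
    have : em / e ≠ 0 := div_ne_zero rm ra
    positivity
  have h4 := (mul_eq_zero.mp hu).resolve_right h3
  rw [div_eq_zero_iff, mul_eq_zero] at h4
  have h5 := sub_eq_zero.mp ((h4.resolve_right t2).resolve_right t1)
  rw [← h5]
  field_simp

end IsFaceModel

/-! ### The Yang–Baxter equation summed over the weights -/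

/-- The factor `[x + u] / [x]` of a face whose two paths coincide, normalized by `[1] / [1 + u]`. -/
def straightFactor (θ : ℂ → ℂ) (x u : ℂ) : ℂ := θ (x + u) / θ x

/-- The factor `[u] [x + η - u] / ([η - u] [x])` of a face whose outer heights coincide, normalized
by `[1] / [1 + u]` and by square roots of `G`. -/
def returnFactor (θ : ℂ → ℂ) (η x u : ℂ) : ℂ := θ u * θ (x + η - u) / (θ (η - u) * θ x)

namespace IsFaceModel
variable {g : AffType} {n : ℕ} {q r : ℂ} {lam : Fin n → ℂ} {rootG : (Fin n → ℤ) → ℂ}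
  {rootT : (Fin n → ℤ) → ℤ → ℤ → ℂ} {κ : ℂ → ℂ}
  {W : (Fin n → ℤ) → (Fin n → ℤ) → (Fin n → ℤ) → (Fin n → ℤ) → ℂ → ℂ}

/-- An instance of the Yang–Baxter equation with a single height `a` on the left and the sum over
all weights on the right.  It is the source of the sum over `J` in the diagonal weights. -/
lemma ybe_pass (H : IsFaceModel g n q r lam rootG rootT κ W) {μ ν σ : ℤ} (hμ : μ ∈ J g n)
    (hν : ν ∈ J g n) (hσ : σ ∈ J g n) (hμ0 : μ ≠ 0) (hν0 : ν ≠ 0) (h1 : μ ≠ ν) (h2 : μ ≠ -ν)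
    (h3 : σ ≠ μ) (h4 : σ ≠ ν) (a : Fin n → ℤ) :
    ∀ᶠ u in codiscrete ℂ, ∀ᶠ v in codiscrete ℂ,
      W (a + hat σ) a a (a + hat ν) u * W a (a + hat μ) (a + hat σ) a (u + v) *
          W (a + hat μ) a a (a + hat ν) v =
      ∑ l ∈ J g n, W a (a + hat μ) (a + hat l) a u * W (a + hat l) a a (a + hat ν) (u + v) *
        W a (a + hat l) (a + hat σ) a v := by
  have h := H.ybe a (a + hat μ) a (a + hat ν) a (a + hat σ)
    (adm_add_hat hμ rfl) (adm_sub_hat hμ rfl) (adm_add_hat hν rfl) (adm_add_hat hσ rfl)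
    (adm_sub_hat hσ rfl) (adm_add_hat hν rfl)
  have hL : ((weights g n).image (a + hat μ + ·)).filter
      (fun x => Adm g n (a + hat σ) x ∧ Adm g n x (a + hat ν)) = {a} := by
    ext x
    simp only [Finset.mem_filter, Finset.mem_image, Finset.mem_singleton]
    constructor
    · rintro ⟨⟨w, hw, hwx⟩, hx1, hx2⟩
      obtain ⟨τ, hτ, hτx⟩ := mem_weights_iff.mp hx2
      have hx : x = a + hat ν - hat τ := by rw [hτx]; abel
      have hw' : w = hat ν + hat (-μ) - hat τ := by
        have : w = x - (a + hat μ) := by rw [← hwx]; abel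
        rw [this, hx, hat_neg]
        abel
      rw [hw'] at hw
      obtain rfl | rfl := eq_or_eq_of_add_sub_mem_weights hτ hν (neg_mem_J hμ) hν0 (by omega)
        (by omega) (by omega) hw
      · rw [hx]; abel
      · rw [hx, Adm, show a + hat ν - hat (-μ) - (a + hat σ) = hat ν + hat μ - hat σ by
          rw [hat_neg]; abel] at hx1
        obtain h5 | h5 := eq_or_eq_of_add_sub_mem_weights hσ hν hμ hν0 hμ0 (by omega) (by omega) hx1
        · exact absurd h5 h4
        · exact absurd h5 h3
    · rintro rfl
      exact ⟨⟨-hat μ, neg_mem_weights (hat_mem_weights hμ), by abel⟩, adm_sub_hat hσ rfl,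
        adm_add_hat hν rfl⟩
  have hR : ((weights g n).image (a + ·)).filter
      (fun x => Adm g n x a ∧ Adm g n x a) = (J g n).image (fun l => a + hat l) := by
    ext x
    simp only [Finset.mem_filter, Finset.mem_image]
    constructor
    · rintro ⟨⟨w, hw, rfl⟩, -, -⟩
      obtain ⟨l, hl, rfl⟩ := mem_weights_iff.mp hw
      exact ⟨l, hl, rfl⟩
    · rintro ⟨l, hl, rfl⟩
      exact ⟨⟨_, hat_mem_weights hl, rfl⟩, adm_sub_hat hl rfl, adm_sub_hat hl rfl⟩
  filter_upwards [h] with u hu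
  filter_upwards [hu] with v hv
  rwa [hL, hR, Finset.sum_singleton, Finset.sum_image] at hv
  intro l hl l' hl' h
  exact hat_injOn hl hl' (add_left_cancel h)

/-- The first and the last weight on the right side of `ybe_pass`. -/
lemma weight_outer (H : IsFaceModel g n q r lam rootG rootT κ W) {σ : ℤ} (hσ : σ ∈ J g n)
    (a : Fin n → ℤ) {s : ℂ → ℂ}
    (hs : ∀ᶠ v in codiscrete ℂ, W a (a + hat σ) (a + hat σ) a v =
      κ v * (theta q r 1 / theta q r (1 + v) *
        (returnFactor (theta q r) (eta g n) (2 * coord g n lam a σ + 1) v *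
          (rootG (a + hat σ) / rootG a) ^ 2 + s v))) :
    ∀ᶠ v in codiscrete ℂ, ∀ l ∈ J g n,
      W a (a + hat l) (a + hat σ) a v = κ v * (theta q r 1 / theta q r (1 + v) *
        (returnFactor (theta q r) (eta g n) (coord g n lam a σ + coord g n lam a l + 1) v *
          (rootG (a + hat σ) / rootG a * (rootG (a + hat l) / rootG a)) +
            if l = σ then s v else 0)) := by
  rw [Filter.eventually_all_finset]
  intro l hl
  by_cases h : l = σ
  · subst h
    filter_upwards [hs] with v hv
    rw [hv, if_pos rfl, ← two_mul, pow_two]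
  · filter_upwards [H.weight_offDiagonal hσ hl (Ne.symm h) a] with v hv
    rw [hv, if_neg h, returnFactor]
    ring

lemma weight_outer_symm (H : IsFaceModel g n q r lam rootG rootT κ W) {μ : ℤ} (hμ : μ ∈ J g n)
    (a : Fin n → ℤ) {s : ℂ → ℂ}
    (hs : ∀ᶠ u in codiscrete ℂ, W a (a + hat μ) (a + hat μ) a u =
      κ u * (theta q r 1 / theta q r (1 + u) *
        (returnFactor (theta q r) (eta g n) (2 * coord g n lam a μ + 1) u *
          (rootG (a + hat μ) / rootG a) ^ 2 + s u))) :
    ∀ᶠ u in codiscrete ℂ, ∀ l ∈ J g n,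
      W a (a + hat μ) (a + hat l) a u = κ u * (theta q r 1 / theta q r (1 + u) *
        (returnFactor (theta q r) (eta g n) (coord g n lam a l + coord g n lam a μ + 1) u *
          (rootG (a + hat μ) / rootG a * (rootG (a + hat l) / rootG a)) +
            if l = μ then s u else 0)) := by
  rw [Filter.eventually_all_finset]
  intro l hl
  by_cases h : l = μ
  · subst h
    filter_upwards [hs] with u hu
    rw [hu, if_pos rfl, ← two_mul, pow_two]
  · filter_upwards [H.weight_offDiagonal hl hμ h a] with u hu
    rw [hu, if_neg h, returnFactor]
    ring

/-- `weight_diagonal` in normalized form. -/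
lemma weight_diagonal' (H : IsFaceModel g n q r lam rootG rootT κ W) {μ ν : ℤ} (hμ : μ ∈ J g n)
    (hν : ν ∈ J g n) (hμ0 : μ ≠ 0) (hν0 : ν ≠ 0) (h1 : μ ≠ ν) (h2 : μ ≠ -ν) (a : Fin n → ℤ) :
    ∀ᶠ u in codiscrete ℂ, W a (a + hat μ) (a + hat μ) a u =
      κ u * (theta q r 1 / theta q r (1 + u) *
        (returnFactor (theta q r) (eta g n) (2 * coord g n lam a μ + 1) u *
          (rootG (a + hat μ) / rootG a) ^ 2 +
            straightFactor (theta q r) (2 * coord g n lam a μ + 1) (-u))) := by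
  filter_upwards [H.weight_diagonal hμ hν hμ0 hν0 h1 h2 a] with u hu
  rw [hu, returnFactor, straightFactor, ← sub_eq_add_neg]
  ring

/-- The middle weight on the right side of `ybe_pass`. -/
lemma weight_middle (H : IsFaceModel g n q r lam rootG rootT κ W) {μ ν : ℤ} (hμ : μ ∈ J g n)
    (hν : ν ∈ J g n) (hμ0 : μ ≠ 0) (hν0 : ν ≠ 0) (h1 : μ ≠ ν) (h2 : μ ≠ -ν) (a : Fin n → ℤ) :
    ∀ᶠ w in codiscrete ℂ, ∀ l ∈ J g n,
      W (a + hat l) a a (a + hat ν) w = κ w * (theta q r 1 / theta q r (1 + w) *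
        (straightFactor (theta q r) (coord g n lam a l + coord g n lam a ν + 1) w +
          if l = ν then returnFactor (theta q r) (eta g n) (-(2 * coord g n lam a ν + 1)) w *
            (rootG a / rootG (a + hat ν)) ^ 2 else 0)) := by
  rw [Filter.eventually_all_finset]
  intro l hl
  by_cases h : l = ν
  · subst h
    have := H.weight_diagonal' (neg_mem_J hν) hμ (by omega) hμ0 (by omega) (by omega) (a + hat l)
    rw [show a + hat l + hat (-l) = a by rw [hat_neg]; abel, coord_add_hat_neg hl] at this
    filter_upwards [this] with w hw
    rw [hw, if_pos rfl, straightFactor, straightFactor,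
      show 2 * (-coord g n lam a l - 1) + 1 = -(2 * coord g n lam a l + 1) by ring,
      show -(2 * coord g n lam a l + 1) + -w = -(2 * coord g n lam a l + 1 + w) by ring,
      H.isTheta.odd, H.isTheta.odd, neg_div_neg_eq, ← two_mul, add_comm (_ / _)]
  · filter_upwards [H.weight_return hl hν h a] with w hw
    rw [hw, if_neg h, straightFactor]
    ring

/-- The Yang–Baxter equation `ybe_pass` in terms of theta functions.  The diagonal weight with
step `σ̂` enters through the function `s`. -/
lemma pass_identity (H : IsFaceModel g n q r lam rootG rootT κ W) {μ ν σ : ℤ} (hμ : μ ∈ J g n)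
    (hν : ν ∈ J g n) (hσ : σ ∈ J g n) (hμ0 : μ ≠ 0) (hν0 : ν ≠ 0) (h1 : μ ≠ ν) (h2 : μ ≠ -ν)
    (h3 : σ ≠ μ) (h4 : σ ≠ ν) (a : Fin n → ℤ) {θ : ℂ → ℂ} (hθ : θ = theta q r) {η m k c : ℂ}
    (hη : η = eta g n) (hm : m = coord g n lam a μ) (hk : k = coord g n lam a ν)
    (hc : c = coord g n lam a σ) {s : ℂ → ℂ}
    (hs : ∀ᶠ v in codiscrete ℂ, W a (a + hat σ) (a + hat σ) a v =
      κ v * (theta q r 1 / theta q r (1 + v) *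
        (returnFactor (theta q r) (eta g n) (2 * coord g n lam a σ + 1) v *
          (rootG (a + hat σ) / rootG a) ^ 2 + s v))) :
    ∀ᶠ u in codiscrete ℂ, ∀ᶠ v in codiscrete ℂ,
      straightFactor θ (c + k + 1) u * returnFactor θ η (c + m + 1) (u + v) *
          straightFactor θ (m + k + 1) v =
      ∑ l ∈ J g n, Gratio g n q r lam a l *
        (returnFactor θ η (coord g n lam a l + m + 1) u *
          straightFactor θ (coord g n lam a l + k + 1) (u + v) *
          returnFactor θ η (c + coord g n lam a l + 1) v) +
      straightFactor θ (2 * m + 1) (-u) * straightFactor θ (m + k + 1) (u + v) *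
        returnFactor θ η (c + m + 1) v +
      returnFactor θ η (k + m + 1) u * returnFactor θ η (-(2 * k + 1)) (u + v) *
        returnFactor θ η (c + k + 1) v +
      returnFactor θ η (c + m + 1) u * straightFactor θ (c + k + 1) (u + v) * s v := by
  have ht := H.isTheta
  filter_upwards [H.ybe_pass hμ hν hσ hμ0 hν0 h1 h2 h3 h4 a, H.weight_return hσ hν h4 a,
    H.weight_outer_symm hμ a (H.weight_diagonal' hμ hν hμ0 hν0 h1 h2 a), H.kappa_ne_zero,
    ht.eventually_add_ne_zero 1] with u hu r1 o1 k1 t1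
  filter_upwards [hu, eventually_codiscrete_add (H.weight_middle hμ hν hμ0 hν0 h1 h2 a) u,
    eventually_codiscrete_add (H.weight_offDiagonal hσ hμ h3 a) u, H.weight_return hμ hν h1 a,
    H.weight_outer hσ a hs, H.kappa_ne_zero,
    eventually_codiscrete_add H.kappa_ne_zero u, ht.eventually_add_ne_zero 1,
    ht.eventually_add_ne_zero (1 + u)] with v hv m1 o2 r2 o3 k2 k3 t2 t3
  rw [r1, o2, r2] at hv
  have e0 := H.rootG_ne_zero a
  have eμ := H.rootG_ne_zero (a + hat μ)
  have eν := H.rootG_ne_zero (a + hat ν)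
  have eσ := H.rootG_ne_zero (a + hat σ)
  have hone := H.theta_one
  rw [← hθ, ← hη] at o1 o3 m1
  rw [← hθ, ← hη, ← hm, ← hk, ← hc] at hv
  rw [← hm] at o1
  rw [← hk] at m1
  rw [← hc] at o3
  rw [← hθ] at t1 t2 t3 hone
  rw [add_assoc] at t3
  set C : ℂ := κ u * κ (u + v) * κ v * θ 1 ^ 3 / (θ (1 + u) * θ (1 + (u + v)) * θ (1 + v)) *
    (rootG (a + hat σ) / rootG a * (rootG (a + hat μ) / rootG a)) with hC
  have hC0 : C ≠ 0 := by
    refine mul_ne_zero (div_ne_zero ?_ ?_) ?_ <;> positivity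
  refine mul_left_cancel₀ hC0 ?_
  have hLHS : C * (straightFactor θ (c + k + 1) u * returnFactor θ η (c + m + 1) (u + v) *
      straightFactor θ (m + k + 1) v) = _ := Eq.trans ?_ hv
  · rw [hLHS]
    rw [Finset.sum_congr rfl (g := fun l => C * (Gratio g n q r lam a l *
        (returnFactor θ η (coord g n lam a l + m + 1) u *
          straightFactor θ (coord g n lam a l + k + 1) (u + v) *
          returnFactor θ η (c + coord g n lam a l + 1) v)) +
        (if l = μ then C * (straightFactor θ (2 * m + 1) (-u) *
          straightFactor θ (m + k + 1) (u + v) * returnFactor θ η (c + m + 1) v) else 0) +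
        (if l = ν then C * (returnFactor θ η (k + m + 1) u *
          returnFactor θ η (-(2 * k + 1)) (u + v) * returnFactor θ η (c + k + 1) v) else 0) +
        (if l = σ then C * (returnFactor θ η (c + m + 1) u *
          straightFactor θ (c + k + 1) (u + v) * s v) else 0))]
    · rw [Finset.sum_add_distrib, Finset.sum_add_distrib, Finset.sum_add_distrib,
        Finset.sum_ite_eq', Finset.sum_ite_eq', Finset.sum_ite_eq', if_pos hμ, if_pos hν, if_pos hσ,
        ← Finset.mul_sum]
      ring
    · intro l hl
      rw [o1 l hl, m1 l hl, o3 l hl, H.Gratio_eq, hC]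
      by_cases hlμ : l = μ
      · rw [hlμ, if_pos rfl, if_neg h1, if_neg h3.symm, ← hm]
        simp only [if_true, if_neg h1, if_neg h3.symm]
        field_simp
        ring
      by_cases hlν : l = ν
      · rw [hlν, ← hk]
        simp only [if_true, if_neg h1.symm, if_neg h4.symm]
        field_simp
        ring
      by_cases hlσ : l = σ
      · rw [hlσ, ← hc]
        simp only [if_true, if_neg h3, if_neg h4]
        field_simp
        ring
      simp only [if_neg hlμ, if_neg hlν, if_neg hlσ]
      field_simp
      ring
  · rw [hC]
    simp only [straightFactor, returnFactor]
    field_simp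

end IsFaceModel

/-! ### Specialization of the spectral parameters -/

/-- A relation that is linear in an arbitrary function `s` of the second variable, with continuous
coefficients, extends from generic to arbitrary values of the first variable: elimination of `s`
from two instances leaves a relation between continuous functions. -/
lemma eventually_of_linear {P N : ℂ → ℂ → ℂ} {s : ℂ → ℂ} (hP₁ : ∀ v, Continuous fun u => P u v)
    (hP₂ : ∀ u, Continuous (P u)) (hN₁ : ∀ v, Continuous fun u => N u v)
    (hN₂ : ∀ u, Continuous (N u)) (hN : ∀ᶠ u in codiscrete ℂ, ∀ᶠ v in codiscrete ℂ, N u v ≠ 0)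
    (h : ∀ᶠ u in codiscrete ℂ, ∀ᶠ v in codiscrete ℂ, P u v + N u v * s v = 0) (w : ℂ) :
    ∀ᶠ v in codiscrete ℂ, P w v + N w v * s v = 0 := by
  obtain ⟨u, hNu, hu⟩ := (hN.and h).exists
  have key : ∀ v, P u v * N w v = P w v * N u v := by
    intro v
    refine eq_of_eventually_codiscrete (f := fun w => P u v * N w v)
      (g := fun w => P w v * N u v) (continuous_const.mul (hN₁ v)) ((hP₁ v).mul continuous_const)
      ?_ w
    filter_upwards [h] with w hw
    refine eq_of_eventually_codiscrete (f := fun v => P u v * N w v)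
      (g := fun v => P w v * N u v) ((hP₂ u).mul (hN₂ w)) ((hP₂ w).mul (hN₂ u)) ?_ v
    filter_upwards [hu, hw] with v h1 h2
    linear_combination N w v * h1 - N u v * h2
  filter_upwards [hu, hNu] with v h1 h2
  refine mul_left_cancel₀ h2 ?_
  linear_combination N w v * h1 - key v

lemma straightFactor_zero {θ : ℂ → ℂ} {x : ℂ} (h : θ x ≠ 0) : straightFactor θ x 0 = 1 := by
  rw [straightFactor, add_zero, div_self h]

section
variable {g : AffType} {n : ℕ} {q r : ℂ} {lam : Fin n → ℂ}

/-- The denominators `[a_{μ,-l} + 1]` of the part (II) weights do not vanish. -/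
lemma theta_coordAdd_add_one_ne_zero (hθ : IsThetaFunction (theta q r)) (h1 : theta q r 1 ≠ 0)
    (hlam : Generic n q r lam) {l μ : ℤ} (hl : l ∈ J g n) (hμ : μ ∈ J g n) (hμ0 : μ ≠ 0)
    (a : Fin n → ℤ) : theta q r (coord g n lam a l + coord g n lam a μ + 1) ≠ 0 := by
  by_cases h : l = μ
  · subst h
    have := theta_two_mul_coord_ne_zero hθ hlam hl hμ0 a 1
    rwa [Int.cast_one, two_mul] at this
  by_cases h' : l = -μ
  · rwa [h', coord_neg hμ0, neg_add_cancel, zero_add]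
  · have := theta_coordAdd_ne_zero hθ hlam hl hμ h h' a 1
    rwa [Int.cast_one] at this

lemma exists_two_mul_eta_eq (g : AffType) (n : ℕ) : ∃ k : ℤ, 2 * eta g n = k := by
  cases g
  · exact ⟨1 - 2 * n, by simp [eta, AffType.t, AffType.dualCoxeter]; ring⟩
  · exact ⟨-2 * (n + 1), by simp [eta, AffType.t, AffType.dualCoxeter]; ring⟩
  · exact ⟨2 - 2 * n, by simp [eta, AffType.t, AffType.dualCoxeter]; ring⟩

end

namespace IsFaceModel
variable {g : AffType} {n : ℕ} {q r : ℂ} {lam : Fin n → ℂ} {rootG : (Fin n → ℤ) → ℂ}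
  {rootT : (Fin n → ℤ) → ℤ → ℤ → ℂ} {κ : ℂ → ℂ}
  {W : (Fin n → ℤ) → (Fin n → ℤ) → (Fin n → ℤ) → (Fin n → ℤ) → ℂ → ℂ}

/-- The residue of `pass_identity` at `u = η`, where only the faces with coinciding outer heights
have a pole. -/
lemma pass_residue (H : IsFaceModel g n q r lam rootG rootT κ W) {μ ν σ : ℤ} (hμ : μ ∈ J g n)
    (hν : ν ∈ J g n) (hσ : σ ∈ J g n) (hμ0 : μ ≠ 0) (hν0 : ν ≠ 0) (h1 : μ ≠ ν) (h2 : μ ≠ -ν)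
    (h3 : σ ≠ μ) (h4 : σ ≠ ν) (a : Fin n → ℤ) {θ : ℂ → ℂ} (hθ : θ = theta q r) {η k c : ℂ}
    (hη : η = eta g n) (hk : k = coord g n lam a ν) (hc : c = coord g n lam a σ)
    (hη0 : θ η ≠ 0) {s : ℂ → ℂ}
    (hs : ∀ᶠ v in codiscrete ℂ, W a (a + hat σ) (a + hat σ) a v =
      κ v * (theta q r 1 / theta q r (1 + v) *
        (returnFactor (theta q r) (eta g n) (2 * coord g n lam a σ + 1) v *
          (rootG (a + hat σ) / rootG a) ^ 2 + s v))) :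
    ∀ᶠ v in codiscrete ℂ,
      θ v * ∑ l ∈ J g n, Gratio g n q r lam a l *
        (straightFactor θ (coord g n lam a l + k + 1) (η + v) *
          (θ (c + coord g n lam a l + 1 + η - v) / θ (c + coord g n lam a l + 1))) -
      θ (η + v) * θ (2 * k + 1 + v) / θ (2 * k + 1) * (θ (c + k + 1 + η - v) / θ (c + k + 1)) +
      straightFactor θ (c + k + 1) (η + v) * θ (η - v) * s v = 0 := by
  have ht : IsThetaFunction θ := hθ ▸ H.isTheta
  have hcont := ht.differentiable.continuous
  set m := coord g n lam a μ with hm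
  have hlm : ∀ l ∈ J g n, θ (coord g n lam a l + m + 1) ≠ 0 := fun l hl => hθ ▸
    theta_coordAdd_add_one_ne_zero H.isTheta H.theta_one H.generic hl hμ hμ0 a
  have hck : θ (c + k + 1) ≠ 0 := by
    rw [hθ, hc, hk]
    exact theta_coordAdd_add_one_ne_zero H.isTheta H.theta_one H.generic hσ hν hν0 a
  have hcm : θ (c + m + 1) ≠ 0 := hc ▸ hlm σ hσ
  have hkm : θ (k + m + 1) ≠ 0 := hk ▸ hlm ν hν
  have h := H.pass_identity hμ hν hσ hμ0 hν0 h1 h2 h3 h4 a hθ hη hm hk hc hs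
  -- the relation multiplied by the common denominator `[η - u] [η - v] [η - u - v]`
  set A : ℂ → ℂ → ℂ := fun x u => θ u * θ (x + η - u) / θ x with hA
  set N : ℂ → ℂ → ℂ := fun u v =>
    A (c + m + 1) u * straightFactor θ (c + k + 1) (u + v) * (θ (η - v) * θ (η - (u + v))) with hN
  set P : ℂ → ℂ → ℂ := fun u v =>
    (∑ l ∈ J g n, Gratio g n q r lam a l *
        (A (coord g n lam a l + m + 1) u *
          straightFactor θ (coord g n lam a l + k + 1) (u + v) *
          A (c + coord g n lam a l + 1) v)) * θ (η - (u + v)) +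
      straightFactor θ (2 * m + 1) (-u) * straightFactor θ (m + k + 1) (u + v) *
        A (c + m + 1) v * (θ (η - u) * θ (η - (u + v))) +
      A (k + m + 1) u * A (-(2 * k + 1)) (u + v) * A (c + k + 1) v -
      straightFactor θ (c + k + 1) u * A (c + m + 1) (u + v) *
          straightFactor θ (m + k + 1) v * (θ (η - u) * θ (η - v)) with hP
  have key := eventually_of_linear (P := P) (N := N) (s := s) ?_ ?_ ?_ ?_ ?_ ?_ η
  · filter_upwards [key, ht.eventually_ne_zero] with v hv tv
    have hAη : ∀ x, θ x ≠ 0 → A x η = θ η := fun x hx => by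
      simp only [hA]
      rw [add_sub_cancel_right, mul_div_cancel_right₀ _ hx]
    simp only [hP, hN] at hv
    rw [hAη _ hcm, hAη _ hkm, sub_self, ht.map_zero, show η - (η + v) = -v by ring, ht.odd,
      Finset.sum_congr rfl (g := fun l => θ η * (θ v * (Gratio g n q r lam a l *
        (straightFactor θ (coord g n lam a l + k + 1) (η + v) *
          (θ (c + coord g n lam a l + 1 + η - v) / θ (c + coord g n lam a l + 1))))))
        (fun l hl => by rw [hAη _ (hlm l hl)]; simp only [hA]; ring), ← Finset.mul_sum,
      ← Finset.mul_sum] at hv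
    have e : A (-(2 * k + 1)) (η + v) = θ (η + v) * θ (2 * k + 1 + v) / θ (2 * k + 1) := by
      simp only [hA]
      rw [show -(2 * k + 1) + η - (η + v) = -(2 * k + 1 + v) by ring, ht.odd, ht.odd, mul_neg,
        neg_div_neg_eq]
    rw [e] at hv
    simp only [hA] at hv
    refine mul_left_cancel₀ (mul_ne_zero hη0 (neg_ne_zero.mpr tv)) ?_
    rw [mul_zero]
    linear_combination hv
  · intro v
    simp only [hP, hA, straightFactor]
    fun_prop
  · intro u
    simp only [hP, hA, straightFactor]
    fun_prop
  · intro v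
    simp only [hN, hA, straightFactor]
    fun_prop
  · intro u
    simp only [hN, hA, straightFactor]
    fun_prop
  · filter_upwards [ht.eventually_ne_zero, ht.eventually_sub_ne_zero (c + m + 1 + η)] with u u1 u2
    filter_upwards [ht.eventually_sub_ne_zero η, ht.eventually_sub_ne_zero (η - u),
      ht.eventually_add_ne_zero (c + k + 1 + u)] with v v1 v2 v3
    simp only [hN, hA, straightFactor]
    rw [sub_sub] at v2
    rw [add_assoc] at v3
    positivity
  · filter_upwards [h, ht.eventually_sub_ne_zero η] with u hu u1
    filter_upwards [hu, ht.eventually_sub_ne_zero η, ht.eventually_sub_ne_zero (η - u)]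
      with v hv v1 v2
    rw [sub_sub] at v2
    have hR : ∀ x w, θ (η - w) ≠ 0 → A x w = returnFactor θ η x w * θ (η - w) := fun x w hw => by
      simp only [hA, returnFactor]
      rw [div_mul_eq_mul_div, mul_comm (θ (η - w)), mul_div_mul_right _ _ hw]
    simp only [hP, hN, hR _ u u1, hR _ v v1, hR _ _ v2]
    rw [Finset.sum_congr rfl (g := fun l => θ (η - u) * θ (η - v) * (Gratio g n q r lam a l *
        (returnFactor θ η (coord g n lam a l + m + 1) u *
          straightFactor θ (coord g n lam a l + k + 1) (u + v) *
          returnFactor θ η (c + coord g n lam a l + 1) v))) (fun l _ => by ring), ← Finset.mul_sum]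
    linear_combination -θ (η - u) * θ (η - v) * θ (η - (u + v)) * hv

/-- The sum over `J` when `[η] ≠ 0`: the relation `pass_residue` at `v = -η`, where its second term
vanishes. -/
lemma sum_eq_of_theta_eta_ne_zero (H : IsFaceModel g n q r lam rootG rootT κ W) {μ ν : ℤ}
    (hμ : μ ∈ J g n) (hν : ν ∈ J g n) (hμ0 : μ ≠ 0) (hν0 : ν ≠ 0) (h1 : μ ≠ ν) (h2 : μ ≠ -ν)
    (a : Fin n → ℤ) {θ : ℂ → ℂ} (hθ : θ = theta q r) {η c : ℂ} (hη : η = eta g n)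
    (hc : c = coord g n lam a μ) (hη0 : θ η ≠ 0) :
    ∑ l ∈ J g n, Gratio g n q r lam a l *
      (θ (c + coord g n lam a l + 1 + 2 * η) / θ (c + coord g n lam a l + 1)) =
    θ (2 * η) * θ (2 * c + 1 + η) / (θ η * θ (2 * c + 1)) := by
  have ht : IsThetaFunction θ := hθ ▸ H.isTheta
  have hcont := ht.differentiable.continuous
  have h := H.pass_residue (neg_mem_J hμ) hν hμ (by omega) hν0 (by omega) (by omega) (by omega)
    h1 a hθ hη rfl hc hη0 (H.weight_diagonal' hμ hν hμ0 hν0 h1 h2 a)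
  set k := coord g n lam a ν with hk
  have hlk : ∀ l ∈ J g n, θ (coord g n lam a l + k + 1) ≠ 0 := fun l hl => hθ ▸
    theta_coordAdd_add_one_ne_zero H.isTheta H.theta_one H.generic hl hν hν0 a
  rw [← hθ, ← hc] at h
  have h' := eq_of_eventually_codiscrete (by simp only [straightFactor]; fun_prop)
    continuous_const h (-η)
  rw [add_neg_cancel, ht.map_zero, straightFactor_zero (hc ▸ hlk μ hμ), ht.odd, neg_neg,
    sub_neg_eq_add, straightFactor, Finset.sum_congr rfl (g := fun l => Gratio g n q r lam a l *
      (θ (c + coord g n lam a l + 1 + 2 * η) / θ (c + coord g n lam a l + 1)))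
      (fun l hl => by
        rw [straightFactor_zero (hlk l hl), one_mul, sub_neg_eq_add, add_assoc _ η η, ← two_mul]),
    show η - -η = 2 * η by ring] at h'
  generalize ∑ l ∈ J g n, Gratio g n q r lam a l *
    (θ (c + coord g n lam a l + 1 + 2 * η) / θ (c + coord g n lam a l + 1)) = S at h' ⊢
  rw [zero_mul, zero_div, zero_mul, sub_zero] at h'
  field_simp at h' ⊢
  linear_combination -h'

/-- The sum over `J` when `[η] = 0`, so that `η` is a quasi-period.  The return factors are then
regular at the origin, and the relation `pass_identity` can be read off at `u = v = 0`. -/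
lemma sum_eq_of_quasiperiod (H : IsFaceModel g n q r lam rootG rootT κ W) {μ ν : ℤ}
    (hμ : μ ∈ J g n) (hν : ν ∈ J g n) (hμ0 : μ ≠ 0) (hν0 : ν ≠ 0) (h1 : μ ≠ ν) (h2 : μ ≠ -ν)
    (a : Fin n → ℤ) {θ : ℂ → ℂ} (hθ : θ = theta q r) {η α β : ℂ} (hη : η = eta g n)
    (hquasi : ∀ x, θ (x + η) = Complex.exp (α * x + β) * θ x) :
    ∑ l ∈ J g n, Gratio g n q r lam a l * Complex.exp (2 * α * (coord g n lam a l + 1)) =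
      2 * Complex.exp α := by
  have ht : IsThetaFunction θ := hθ ▸ H.isTheta
  have hcont := ht.differentiable.continuous
  set k := coord g n lam a ν with hk
  set c := coord g n lam a μ with hc
  set m := coord g n lam a (-μ) with hm
  have hx : ∀ l ∈ J g n, ∀ τ ∈ J g n, τ ≠ 0 → θ (coord g n lam a l + coord g n lam a τ + 1) ≠ 0 :=
    fun l hl τ hτ hτ0 => hθ ▸
      theta_coordAdd_add_one_ne_zero H.isTheta H.theta_one H.generic hl hτ hτ0 a
  have h := H.pass_identity (neg_mem_J hμ) hν hμ (by omega) hν0 (by omega) (by omega) (by omega)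
    h1 a hθ hη hm hk hc (H.weight_diagonal' hμ hν hμ0 hν0 h1 h2 a)
  rw [← hθ, ← hc] at h
  -- at a quasi-period, the poles of the return factor cancel
  set R : ℂ → ℂ → ℂ := fun x u => -(Complex.exp (α * x) * θ (x - u) / θ x) with hR
  have hret : ∀ x u, θ u ≠ 0 → returnFactor θ η x u = R x u := by
    intro x u hu
    simp only [returnFactor, hR]
    rw [show x + η - u = (x - u) + η by ring, show η - u = -u + η by ring, hquasi, hquasi, ht.odd,
      show α * (x - u) + β = α * x + (α * -u + β) by ring, Complex.exp_add (α * x)]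
    have := Complex.exp_ne_zero (α * -u + β)
    by_cases hθx : θ x = 0
    · simp [hθx]
    field_simp
  have hR0 : ∀ x, θ x ≠ 0 → R x 0 = -Complex.exp (α * x) := fun x hx => by
    simp only [hR]
    rw [sub_zero, mul_div_cancel_right₀ _ hx]
  set L : ℂ → ℂ → ℂ := fun u v => straightFactor θ (c + k + 1) u * R (c + m + 1) (u + v) *
          straightFactor θ (m + k + 1) v with hL
  set Rt : ℂ → ℂ → ℂ := fun u v => ∑ l ∈ J g n, Gratio g n q r lam a l *
        (R (coord g n lam a l + m + 1) u *
          straightFactor θ (coord g n lam a l + k + 1) (u + v) *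
          R (c + coord g n lam a l + 1) v) +
      straightFactor θ (2 * m + 1) (-u) * straightFactor θ (m + k + 1) (u + v) *
        R (c + m + 1) v +
      R (k + m + 1) u * R (-(2 * k + 1)) (u + v) * R (c + k + 1) v +
      R (c + m + 1) u * straightFactor θ (c + k + 1) (u + v) *
        straightFactor θ (2 * c + 1) (-v) with hRt
  have key : L 0 0 = Rt 0 0 := by
    refine eq_of_eventually_codiscrete (f := fun u => L u 0) (g := fun u => Rt u 0) ?_ ?_ ?_ 0
    · simp only [hL, hR, straightFactor]
      fun_prop
    · simp only [hRt, hR, straightFactor]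
      fun_prop
    filter_upwards [h, ht.eventually_ne_zero] with u hu u1
    refine eq_of_eventually_codiscrete (f := fun v => L u v) (g := fun v => Rt u v) ?_ ?_ ?_ 0
    · simp only [hL, hR, straightFactor]
      fun_prop
    · simp only [hRt, hR, straightFactor]
      fun_prop
    filter_upwards [hu, ht.eventually_ne_zero, ht.eventually_add_ne_zero u] with v hv v1 v2
    simp only [hret _ _ u1, hret _ _ v1, hret _ _ v2] at hv
    exact hv
  have n1 : θ (c + k + 1) ≠ 0 := hx μ hμ ν hν hν0
  have n2 : θ (m + k + 1) ≠ 0 := hx (-μ) (neg_mem_J hμ) ν hν hν0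
  have n3 : θ (c + m + 1) ≠ 0 := hx μ hμ (-μ) (neg_mem_J hμ) (by omega)
  have n4 : θ (2 * m + 1) ≠ 0 := by
    rw [two_mul]
    exact hx (-μ) (neg_mem_J hμ) (-μ) (neg_mem_J hμ) (by omega)
  have n5 : θ (k + m + 1) ≠ 0 := hx ν hν (-μ) (neg_mem_J hμ) (by omega)
  have n6 : θ (2 * c + 1) ≠ 0 := by
    rw [two_mul]
    exact hx μ hμ μ hμ hμ0
  have n7 : θ (2 * k + 1) ≠ 0 := by
    rw [two_mul]
    exact hx ν hν ν hν hν0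
  have n8 : θ (-(2 * k + 1)) ≠ 0 := by
    rw [ht.odd]
    exact neg_ne_zero.mpr n7
  have hmc : m = -c := coord_neg hμ0 a
  simp only [hL, hRt, add_zero, neg_zero] at key
  rw [straightFactor_zero n1, straightFactor_zero n2, straightFactor_zero n4,
    straightFactor_zero n6, hR0 _ n3, hR0 _ n5, hR0 _ n8, hR0 _ n1,
    Finset.sum_congr rfl (g := fun l => Gratio g n q r lam a l *
      Complex.exp (2 * α * (coord g n lam a l + 1))) (fun l hl => by
        have l1 : θ (coord g n lam a l + k + 1) ≠ 0 := hx l hl ν hν hν0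
        have l2 : θ (coord g n lam a l + m + 1) ≠ 0 :=
          hx l hl (-μ) (neg_mem_J hμ) (by omega)
        have l3 : θ (c + coord g n lam a l + 1) ≠ 0 := by
          rw [add_comm c]
          exact hx l hl μ hμ hμ0
        rw [straightFactor_zero l1, hR0 _ l2, hR0 _ l3, mul_one, neg_mul_neg, ← Complex.exp_add]
        congr 2
        rw [hmc]
        ring)] at key
  have e1 : Complex.exp (α * (k + m + 1)) * Complex.exp (α * -(2 * k + 1)) *
      Complex.exp (α * (c + k + 1)) = Complex.exp α := by
    rw [← Complex.exp_add, ← Complex.exp_add]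
    congr 1
    rw [hmc]
    ring
  have e2 : Complex.exp (α * (c + m + 1)) = Complex.exp α := by
    congr 1
    rw [hmc]
    ring
  rw [e2] at key
  linear_combination -key + e1

/-- The sum over `J` that enters the diagonal weights, with the term of `μ` included, in a form that
does not distinguish whether `[η]` vanishes. -/
lemma sum_identity (H : IsFaceModel g n q r lam rootG rootT κ W) {μ ν : ℤ}
    (hμ : μ ∈ J g n) (hν : ν ∈ J g n) (hμ0 : μ ≠ 0) (hν0 : ν ≠ 0) (h1 : μ ≠ ν) (h2 : μ ≠ -ν)
    (a : Fin n → ℤ) {θ : ℂ → ℂ} (hθ : θ = theta q r) {η c x : ℂ} (hη : η = eta g n)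
    (hc : c = coord g n lam a μ) (hx : x = 2 * c + 1) (t : ℂ) :
    (∑ l ∈ J g n, Gratio g n q r lam a l *
      (θ (c + coord g n lam a l + 1 + 2 * η) / θ (c + coord g n lam a l + 1))) *
      (θ t * θ (x + η - t) * θ x) =
    θ (η + t) * θ (x + 2 * η - t) * θ x - θ (η - t) * θ (x - t) * θ (x + 2 * η) := by
  have ht : IsThetaFunction θ := hθ ▸ H.isTheta
  have hlc : ∀ l ∈ J g n, θ (c + coord g n lam a l + 1) ≠ 0 := fun l hl => by
    rw [hθ, add_comm c, hc]
    exact theta_coordAdd_add_one_ne_zero H.isTheta H.theta_one H.generic hl hμ hμ0 a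
  have hx0 : θ x ≠ 0 := by
    have := hlc μ hμ
    rwa [← hc, ← two_mul, ← hx] at this
  by_cases hη0 : θ η = 0
  · obtain ⟨α, β, hquasi⟩ := ht.quasiperiodic η hη0
    have hS := H.sum_eq_of_quasiperiod hμ hν hμ0 hν0 h1 h2 a hθ hη hquasi
    have hq2 : ∀ y, θ (y + 2 * η) = Complex.exp (2 * α * y + α * η + 2 * β) * θ y := fun y => by
      rw [two_mul, ← add_assoc, hquasi, hquasi, ← mul_assoc, ← Complex.exp_add]
      congr 2
      ring
    rw [Finset.sum_congr rfl (g := fun l => Complex.exp (2 * α * c + α * η + 2 * β) *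
      (Gratio g n q r lam a l * Complex.exp (2 * α * (coord g n lam a l + 1)))) (fun l hl => by
        rw [hq2, mul_div_cancel_right₀ _ (hlc l hl), mul_left_comm, ← Complex.exp_add]
        congr 2
        ring), ← Finset.mul_sum, hS]
    rw [show x + η - t = (x - t) + η by ring, show η + t = t + η by ring,
      show x + 2 * η - t = (x - t) + 2 * η by ring, show η - t = -t + η by ring, hquasi, hquasi,
      hquasi, hq2, hq2, ht.odd]
    have e1 : Complex.exp (2 * α * c + α * η + 2 * β) * Complex.exp α *
        Complex.exp (α * (x - t) + β) =
        Complex.exp (α * t + β) * Complex.exp (2 * α * (x - t) + α * η + 2 * β) := by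
      rw [← Complex.exp_add, ← Complex.exp_add, ← Complex.exp_add]
      congr 1
      rw [hx]
      ring
    have e2 : Complex.exp (2 * α * c + α * η + 2 * β) * Complex.exp α *
        Complex.exp (α * (x - t) + β) =
        Complex.exp (α * -t + β) * Complex.exp (2 * α * x + α * η + 2 * β) := by
      rw [← Complex.exp_add, ← Complex.exp_add, ← Complex.exp_add]
      congr 1
      rw [hx]
      ring
    linear_combination θ t * θ (x - t) * θ x * (e1 + e2)
  · have hw := ht.three_term ((2 * η + t) / 2) ((2 * η - t) / 2) ((2 * x + 2 * η - t) / 2) (t / 2)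
      (a₁ := 2 * η) (a₂ := t) (a₃ := x + η) (a₄ := x + η - t) (b₁ := x + 2 * η) (b₂ := -(x - t))
      (b₃ := η) (b₄ := η - t) (c₁ := η + t) (c₂ := η) (c₃ := x + 2 * η - t) (c₄ := -x)
    simp only [ht.odd] at hw
    rw [H.sum_eq_of_theta_eta_ne_zero hμ hν hμ0 hν0 h1 h2 a hθ hη hc hη0, ← hx]
    field_simp
    linear_combination hw

end IsFaceModel

/-! ### The diagonal weights -/

namespace IsThetaFunction
variable {θ : ℂ → ℂ}

/-- The expansion of a product of two shifted thetas, by which a sum of such products over the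
weights splits into two sums with one factor each. -/
lemma pass_decomposition (ht : IsThetaFunction θ) (x K η v : ℂ) :
    θ (x + K + η + v) * θ (x + η - v) * (θ K * θ (2 * η)) =
      θ (η - v) * θ (K + η + v) * (θ (x + 2 * η) * θ (x + K)) +
        θ (K + v - η) * θ (η + v) * (θ (x + K + 2 * η) * θ x) := by
  have h := ht.three_term ((2 * x + K + 2 * η) / 2) ((K + 2 * v) / 2) ((2 * η + K) / 2)
    ((2 * η - K) / 2) (a₁ := x + K + η + v) (a₂ := x + η - v) (a₃ := 2 * η) (a₄ := K)
    (b₁ := x + K + 2 * η) (b₂ := x) (b₃ := η + v) (b₄ := K + v - η)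
    (c₁ := x + 2 * η) (c₂ := x + K) (c₃ := K + η + v) (c₄ := -(η - v))
  rw [ht.odd] at h
  linear_combination h

/-- The theta function identity behind the weight of the face with four equal heights. -/
lemma pass_relation (ht : IsThetaFunction θ) (K η v : ℂ) :
    θ (K + η + v) * θ (2 * η - v) * (θ (2 * K) * θ K * θ η) =
      θ (2 * K + v) * θ (K + η - v) * (θ (2 * η) * θ K * θ η) -
        θ v * θ (K + v - η) *
          (θ (2 * η) * θ (2 * K + η) * θ K - θ (K + 2 * η) * θ η * θ (2 * K)) := by
  have h1 := ht.three_term ((3 * K + v) / 2) ((K + v) / 2) ((K + 2 * η - v) / 2) ((K - v) / 2)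
    (a₁ := 2 * K + v) (a₂ := K) (a₃ := K + η - v) (a₄ := η) (b₁ := 2 * K + η)
    (b₂ := K + v - η) (b₃ := K) (b₄ := v) (c₁ := 2 * K) (c₂ := K + v) (c₃ := K + η)
    (c₄ := v - η)
  have h2 := ht.three_term ((K + 2 * η + v) / 2) ((K + v) / 2) ((2 * η - v + K) / 2)
    ((2 * η - v - K) / 2) (a₁ := K + η + v) (a₂ := η) (a₃ := 2 * η - v) (a₄ := K)
    (b₁ := K + 2 * η) (b₂ := v) (b₃ := η) (b₄ := K + v - η) (c₁ := 2 * η) (c₂ := K + v)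
    (c₃ := K + η) (c₄ := v - η)
  linear_combination θ (2 * K) * h2 - θ (2 * η) * h1

end IsThetaFunction

namespace IsFaceModel
variable {g : AffType} {n : ℕ} {q r : ℂ} {lam : Fin n → ℂ} {rootG : (Fin n → ℤ) → ℂ}
  {rootT : (Fin n → ℤ) → ℤ → ℤ → ℂ} {κ : ℂ → ℂ}
  {W : (Fin n → ℤ) → (Fin n → ℤ) → (Fin n → ℤ) → (Fin n → ℤ) → ℂ → ℂ}

/-- The diagonal weights of part (II) for a nonzero weight `μ̂`. -/
lemma weight_diagonal_eq (H : IsFaceModel g n q r lam rootG rootT κ W) {μ ν : ℤ}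
    (hμ : μ ∈ J g n) (hν : ν ∈ J g n) (hμ0 : μ ≠ 0) (hν0 : ν ≠ 0) (h1 : μ ≠ ν) (h2 : μ ≠ -ν)
    (a : Fin n → ℤ) {θ : ℂ → ℂ} (hθ : θ = theta q r) {η c : ℂ} (hη : η = eta g n)
    (hc : c = coord g n lam a μ) :
    ∀ᶠ u in codiscrete ℂ, W a (a + hat μ) (a + hat μ) a u =
      κ u * (θ (η + u) * θ 1 * θ (c + c + 1 + 2 * η - u) /
          (θ (η - u) * θ (1 + u) * θ (c + c + 1 + 2 * η)) -
        θ u * θ 1 * θ (c + c + 1 + η - u) / (θ (η - u) * θ (1 + u) * θ (c + c + 1 + 2 * η)) *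
          ∑ k ∈ (J g n).erase μ, θ (c + coord g n lam a k + 1 + 2 * η) /
            θ (c + coord g n lam a k + 1) * Gratio g n q r lam a k) := by
  have ht : IsThetaFunction θ := hθ ▸ H.isTheta
  obtain ⟨x, hx⟩ : ∃ x, x = 2 * c + 1 := ⟨_, rfl⟩
  have hx0 : θ x ≠ 0 := by
    have := theta_two_mul_coord_ne_zero H.isTheta H.generic hμ hμ0 a 1
    rwa [Int.cast_one, ← hc, ← hx, ← hθ] at this
  have hx2 : θ (x + 2 * η) ≠ 0 := by
    obtain ⟨k, hk⟩ := exists_two_mul_eta_eq g n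
    have := theta_two_mul_coord_ne_zero H.isTheta H.generic hμ hμ0 a (1 + k)
    rwa [Int.cast_add, Int.cast_one, ← hk, ← hc, ← hθ, ← hη, ← add_assoc, ← hx] at this
  filter_upwards [H.weight_diagonal' hμ hν hμ0 hν0 h1 h2 a, ht.eventually_sub_ne_zero η,
    ht.eventually_add_ne_zero 1] with u hu u1 u2
  have hS := H.sum_identity hμ hν hμ0 hν0 h1 h2 a hθ hη hc hx u
  rw [← Finset.add_sum_erase _ _ hμ, ← hc, ← two_mul, ← hx] at hS
  rw [hu, ← hθ, ← hη, ← hc, ← H.Gratio_eq, ← two_mul, ← hx]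
  simp only [mul_comm (θ _ / θ _) (Gratio _ _ _ _ _ _ _)]
  generalize ∑ k ∈ (J g n).erase μ, Gratio g n q r lam a k *
    (θ (c + coord g n lam a k + 1 + 2 * η) / θ (c + coord g n lam a k + 1)) = S at hS ⊢
  simp only [straightFactor, returnFactor, ← sub_eq_add_neg]
  congr 1
  field_simp at hS ⊢
  linear_combination θ 1 * hS

/-- The weight of the face with four equal heights in type `B`: the relation `pass_residue` with
`σ = 0` is linear in this weight, and the sum in it is reduced to two sums by
`pass_decomposition`. -/
lemma weight_zero_eq (H : IsFaceModel g n q r lam rootG rootT κ W) {μ ν : ℤ}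
    (hμ : μ ∈ J g n) (hν : ν ∈ J g n) (h0 : (0 : ℤ) ∈ J g n) (hμ0 : μ ≠ 0) (hν0 : ν ≠ 0)
    (h1 : μ ≠ ν) (h2 : μ ≠ -ν) (a : Fin n → ℤ) {θ : ℂ → ℂ} (hθ : θ = theta q r) {η c : ℂ}
    (hη : η = eta g n) (hη2 : θ (2 * η) ≠ 0) (hc : c = coord g n lam a 0) :
    ∀ᶠ u in codiscrete ℂ, W a (a + hat 0) (a + hat 0) a u =
      κ u * (θ (η + u) * θ 1 * θ (c + c + 1 + 2 * η - u) /
          (θ (η - u) * θ (1 + u) * θ (c + c + 1 + 2 * η)) -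
        θ u * θ 1 * θ (c + c + 1 + η - u) / (θ (η - u) * θ (1 + u) * θ (c + c + 1 + 2 * η)) *
          ∑ k ∈ (J g n).erase 0, θ (c + coord g n lam a k + 1 + 2 * η) /
            θ (c + coord g n lam a k + 1) * Gratio g n q r lam a k) := by
  have ht : IsThetaFunction θ := hθ ▸ H.isTheta
  have hη0 := ht.ne_zero_of_two_mul hη2
  have hone : θ 1 ≠ 0 := hθ ▸ H.theta_one
  have hc' : c = -(1 / 2) := by rw [hc, coord_zero]
  set k := coord g n lam a ν with hk
  obtain ⟨K, hK⟩ : ∃ K, K = k + 1 / 2 := ⟨_, rfl⟩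
  have hK0 : θ K ≠ 0 := by
    have := theta_coordAdd_add_one_ne_zero H.isTheta H.theta_one H.generic h0 hν hν0 a
    rwa [← hθ, ← hc, ← hk, hc', show -(1 / 2) + k + 1 = K by rw [hK]; ring] at this
  have h2K : θ (2 * K) ≠ 0 := by
    have := theta_two_mul_coord_ne_zero H.isTheta H.generic hν hν0 a 1
    rwa [Int.cast_one, ← hk, ← hθ, show 2 * k + 1 = 2 * K by rw [hK]; ring] at this
  -- at the zero weight the return factor has the denominator `[0]`, hence, by `x / 0 = 0`, the
  -- value zero, so that `s` is the whole normalized weight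
  have hret : ∀ v, returnFactor θ η (2 * c + 1) v = 0 := fun v => by
    rw [returnFactor, show 2 * c + 1 = 0 by rw [hc']; ring, ht.map_zero, mul_zero, div_zero]
  set s : ℂ → ℂ := fun v => W a (a + hat 0) (a + hat 0) a v / κ v * θ (1 + v) / θ 1 with hs
  have hW : ∀ᶠ v in codiscrete ℂ, W a (a + hat 0) (a + hat 0) a v =
      κ v * (θ 1 / θ (1 + v) * s v) := by
    filter_upwards [H.kappa_ne_zero, ht.eventually_add_ne_zero 1] with v v1 v2
    simp only [hs]
    field_simp
  have hres := H.pass_residue hμ hν h0 hμ0 hν0 h1 h2 hμ0.symm hν0.symm a hθ hη hk hc hη0 (s := s)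
    (by
      filter_upwards [hW] with v hv
      rw [hv, ← hθ, ← hη, ← hc, hret, zero_mul, zero_add])
  have hSk := H.sum_eq_of_theta_eta_ne_zero hν hμ hν0 hμ0 h1.symm (by omega) a hθ hη hk hη0
  have hG0 : Gratio g n q r lam a 0 = 1 := by
    rw [Gratio, hat_zero, add_zero, div_self (G_ne_zero H.isTheta H.generic a)]
  rw [← Finset.add_sum_erase _ _ h0, hG0, ← hc, one_mul, hc',
    show k + -(1 / 2) + 1 = K by rw [hK]; ring, show 2 * k + 1 = 2 * K by rw [hK]; ring] at hSk
  filter_upwards [hW, hres, ht.eventually_sub_ne_zero η, ht.eventually_add_ne_zero 1,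
    ht.eventually_add_ne_zero (K + η)] with v hv hres v1 v2 v3
  -- likewise the term of the zero weight in the sum is zero
  rw [← Finset.add_sum_erase _ _ h0, ← hc, show c + c + 1 = 0 by rw [hc']; ring, ht.map_zero,
    div_zero, mul_zero, mul_zero, zero_add, show c + k + 1 = K by rw [hc', hK]; ring,
    show 2 * k + 1 = 2 * K by rw [hK]; ring, straightFactor] at hres
  set S' : ℂ := ∑ l ∈ (J g n).erase 0, θ (c + coord g n lam a l + 1 + 2 * η) /
            θ (c + coord g n lam a l + 1) * Gratio g n q r lam a l with hS'
  set Sk : ℂ := ∑ l ∈ (J g n).erase 0, Gratio g n q r lam a l *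
    (θ (k + coord g n lam a l + 1 + 2 * η) / θ (k + coord g n lam a l + 1)) with hSk'
  have hsum : (∑ l ∈ (J g n).erase 0, Gratio g n q r lam a l *
      (straightFactor θ (coord g n lam a l + k + 1) (η + v) *
        (θ (c + coord g n lam a l + 1 + η - v) / θ (c + coord g n lam a l + 1)))) *
        (θ K * θ (2 * η)) =
      θ (η - v) * θ (K + η + v) * S' + θ (K + v - η) * θ (η + v) * Sk := by
    rw [hS', hSk', Finset.mul_sum, Finset.mul_sum, Finset.sum_mul, ← Finset.sum_add_distrib]
    refine Finset.sum_congr rfl fun l hl => ?_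
    obtain ⟨hl0, hl⟩ := Finset.mem_erase.mp hl
    obtain ⟨x, hx⟩ : ∃ x, x = c + coord g n lam a l + 1 := ⟨_, rfl⟩
    have e1 : coord g n lam a l + k + 1 = x + K := by rw [hx, hK, hc']; ring
    have e2 : k + coord g n lam a l + 1 = x + K := by rw [hx, hK, hc']; ring
    have n1 : θ x ≠ 0 := by
      have := theta_coordAdd_add_one_ne_zero H.isTheta H.theta_one H.generic h0 hl hl0 a
      rwa [← hθ, ← hc, ← hx] at this
    have n2 : θ (x + K) ≠ 0 := by
      have := theta_coordAdd_add_one_ne_zero H.isTheta H.theta_one H.generic hl hν hν0 a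
      rwa [← hθ, ← hk, e1] at this
    have hd := ht.pass_decomposition x K η v
    rw [straightFactor, e1, e2, ← hx, ← add_assoc]
    generalize 2 * η = d at hd ⊢
    field_simp
    linear_combination Gratio g n q r lam a l * hd
  have hrel := ht.pass_relation K η v
  rw [hv, show c + c + 1 = 0 by rw [hc']; ring, zero_add, zero_add]
  rw [← add_assoc] at hres
  generalize (∑ l ∈ (J g n).erase 0, Gratio g n q r lam a l *
      (straightFactor θ (coord g n lam a l + k + 1) (η + v) *
        (θ (c + coord g n lam a l + 1 + η - v) / θ (c + coord g n lam a l + 1)))) = T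
    at hsum hres
  have hsol : s v = θ (η + v) * θ (2 * η - v) / (θ (η - v) * θ (2 * η)) -
      θ v / θ (2 * η) * S' := by
    have hSk2 : Sk = θ (2 * η) * θ (2 * K + η) / (θ η * θ (2 * K)) - θ (K + 2 * η) / θ K := by
      linear_combination hSk
    have hT : T = (θ (η - v) * θ (K + η + v) * S' + θ (K + v - η) * θ (η + v) * Sk) /
        (θ K * θ (2 * η)) := by rw [eq_div_iff (mul_ne_zero hK0 hη2), hsum]
    rw [hT, hSk2] at hres
    generalize θ (2 * η) = d at hres hη2 hrel ⊢
    generalize θ (2 * K + η) = e₁, θ (2 * K + v) = e₂, θ (2 * K) = e, θ (2 * η - v) = f,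
      θ (K + 2 * η) = h at hres h2K hrel ⊢
    field_simp at hres ⊢
    refine mul_left_cancel₀ (mul_ne_zero v3 (mul_ne_zero hη0 (mul_ne_zero h2K hK0))) ?_
    linear_combination hres - θ (η + v) * hrel
  rw [hsol]
  congr 1
  field_simp

/-- The weights of part (II). -/
theorem partII (H : IsFaceModel g n q r lam rootG rootT κ W) (hn : g.minRank ≤ n)
    (h_eta : g = .B → theta q r (2 * eta g n) ≠ 0) : PartII g n q r lam rootG κ W := by
  have hn2 : 2 ≤ n := le_trans (by cases g <;> simp [AffType.minRank]) hn
  have m1 : (1 : ℤ) ∈ J g n := mem_J_iff.mpr ⟨by omega, by omega, by omega⟩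
  have m2 : (2 : ℤ) ∈ J g n := mem_J_iff.mpr ⟨by omega, by omega, by omega⟩
  refine ⟨fun a μ hμ ν hν hne => H.weight_offDiagonal hμ hν hne a, fun a μ hμ => ?_⟩
  by_cases hμ0 : μ = 0
  · subst hμ0
    exact H.weight_zero_eq m1 m2 hμ (by omega) (by omega) (by omega) (by omega) a rfl rfl
      (h_eta ((mem_J_iff.mp hμ).2.2 rfl)) rfl
  · by_cases h : μ = 1 ∨ μ = -1
    · exact H.weight_diagonal_eq hμ m2 hμ0 (by omega) (by omega) (by omega) a rfl rfl rfl
    · exact H.weight_diagonal_eq hμ m1 hμ0 (by omega) (by omega) (by omega) a rfl rfl rfl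

end IsFaceModel

end FaceModel

end

theorem mainTheorem7
    (g : FaceModel.AffType) (n : ℕ) (hn : g.minRank ≤ n)
    (q r : ℂ) (hq : q ≠ 0) (hp : ‖FaceModel.nome q r‖ < 1)
    (h_one : FaceModel.theta q r 1 ≠ 0)
    (h_eta : g = FaceModel.AffType.B → FaceModel.theta q r (2 * FaceModel.eta g n) ≠ 0)
    (lam : Fin n → ℂ) (h_lam : FaceModel.Generic n q r lam)
    (rootG : (Fin n → ℤ) → ℂ) (h_rootG : FaceModel.IsRootG g n q r lam rootG)
    (rootT : (Fin n → ℤ) → ℤ → ℤ → ℂ) (h_rootT : FaceModel.IsRootT g n q r lam rootT)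
    (κ : ℂ → ℂ) (h_kappa : FaceModel.IsKappa g n q r κ)
    (W : (Fin n → ℤ) → (Fin n → ℤ) → (Fin n → ℤ) → (Fin n → ℤ) → ℂ → ℂ)
    (h_partI : FaceModel.PartI g n q r lam rootT κ W)
    (h_ybe : FaceModel.YangBaxter g n W)
    (h_cross : FaceModel.Crossing g n rootG W) :
    FaceModel.PartII g n q r lam rootG κ W := by
  have H : FaceModel.IsFaceModel g n q r lam rootG rootT κ W :=
    ⟨FaceModel.isThetaFunction_theta hq hp h_one, h_one, h_lam, h_rootG, h_rootT, h_kappa,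
      h_partI, h_ybe, h_cross⟩
  exact H.partII hn h_eta
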